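/- **Setting.** Let $G$ be a connected finite-dimensional real Lie group with Lie algebra $\mathfrak g$, let $\mathrm{Ad}^*(g)$ be the algebraic dual of $\mathrm{Ad}(g)$, $\langle \mathrm{Ad}^*(g)j,\xi\rangle=\langle j,\mathrm{Ad}(g)\xi\rangle$, and let $G\ltimes\mathfrak g^*$ carry the product $(u_1,a_1)(u_2,a_2)=(u_1u_2,\,a_1+\mathrm{Ad}^*(u_1^{-1})a_2)$. Its Lie algebra is $\mathfrak g\oplus\mathfrak g^*$ with $[(\xi,j),(\eta,l)]=([\xi,\eta],\mathrm{ad}^*_\xi l-\mathrm{ad}^*_\eta j)$, $\mathrm{ad}^*_\xi l=-l\circ\mathrm{ad}\,\xi$, and with the invariant pairing $\langle(\xi,j),(\eta,l)\rangle=\langle j,\eta\rangle+\langle l,\xi\rangle$. Every element of $G\ltimes\mathfrak g^*$ is written uniquely as $X=(u_X,-\mathrm{Ad}^*(u_X^{-1})j_X)$. Let $\mathfrak c\subset\mathfrak g\oplus\mathfrak g^*$ be an abelian Cartan subalgebra, $T_{\mathfrak c}$ the subgroup obtained by exponentiating it, $k\in\mathbb R$, $n,g\ge 0$ integers, and fix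 $(\mu_i,s_i)\in\mathfrak g\oplus\mathfrak g^*$, $i=1,\dots,n$. The variables are $(v_{M_i},x_{M_i})\in G\ltimes\mathfrak g^*$ ($1\le i\le n$), $A_j,B_j\in G\ltimes\mathfrak g^*$ ($1\le j\le g$), $g_\infty=(v_\infty,x_\infty)$, $w\in G\ltimes\mathfrak g^*$ and $(\mu,s)\in\mathfrak c$. Put $M_i=(v_{M_i},x_{M_i})(e^{-\mu_i},-s_i)(v_{M_i},x_{M_i})^{-1}$ and, with $[b,a]=bab^{-1}a^{-1}$, $$K_{n+2g}^{-1}=[B_g,A_g^{-1}]\cdots[B_1,A_1^{-1}]M_n\cdots M_1 .$$ The constraint surface $\mathcal C$ is the set of all variables with $K_{n+2g}^{-1}=g_\infty(e^{-\mu},-s)g_\infty^{-1}$. Let $\delta$ be the exterior derivative, write $u_{H_i}=u_{B_i}u_{A_i}^{-1}u_{B_i}^{-1}u_{A_i}$, $U_i=u_{M_{i-1}}\cdots u_{M_1}$, $P_i=u_{H_{i-1}}\cdots u_{H_1}u_{M_n}\cdots u_{M_1}$, $Q_i=u_{A_i}^{-1}u_{B_i}^{-1}u_{A_i}P_i$,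 $R_i=u_{B_i}^{-1}u_{A_i}P_i$, and define the one-form $$\Theta(v_{M_i},j_{M_i},u_{A_j},j_{A_j},u_{B_j},j_{B_j})=\sum_{i=1}^n\langle \delta U_i\,U_i^{-1}-\delta v_{M_i}v_{M_i}^{-1},\,j_{M_i}\rangle+\sum_{i=1}^g\Big(\langle \delta P_i P_i^{-1}-\delta Q_i Q_i^{-1},\,j_{A_i}\rangle+\langle \delta Q_i Q_i^{-1}-\delta R_i R_i^{-1},\,j_{B_i}\rangle\Big)$$ and the two-form on $\mathcal C$ $$\Omega=\tfrac{k}{2\pi}\,\delta\Big(\langle(\mu,s),w^{-1}\delta w\rangle+\Theta+\langle j_{K_{n+2g}},\delta v_\infty v_\infty^{-1}\rangle-\langle \mathrm{Ad}^*(v_\infty)x_\infty-\tfrac12 s,\,\delta\mu\rangle\Big),$$ where $j_{K_{n+2g}}$ denotes the $j$-coordinate of $K_{n+2g}^{-1}$. As $\mathcal C$ need not be a manifold everywhere, forms on $\mathcal C$ are given by their pull-backs along smooth families of points of $\mathcal C$ parametrised by open subsets of finite-dimensional vector spaces. **Theorem.** 1. For $h\in G\ltimes\mathfrak g^*$ consider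 the transformation $(v_{M_i},x_{M_i})\mapsto h(v_{M_i},x_{M_i})$, $g_\infty\mapsto hg_\infty$, $A_j\mapsto hA_jh^{-1}$, $B_j\mapsto hB_jh^{-1}$, with $w$ and $(\mu,s)$ unchanged. It conjugates all $M_i$ and $K_{n+2g}$ by $h$, it maps $\mathcal C$ to $\mathcal C$, and it is a gauge transformation for $\Omega$: the two-form $\Omega$ on $\mathcal C$ does not change when the variables are transformed by an arbitrary smooth, field-dependent $h$, and $\iota_Z\Omega=0$ on $\mathcal C$ for every vector field $Z$ that generates the action infinitesimally. 2. In terms of the variables $\tilde M_i=g_\infty^{-1}M_ig_\infty$, $\tilde A_j=g_\infty^{-1}A_jg_\infty$, $\tilde B_j=g_\infty^{-1}B_jg_\infty$, $\tilde v_{M_i}=v_\infty^{-1}v_{M_i}$, one has on $\mathcal C$ $$\Omega=\tfrac{k}{2\pi}\,\delta\Big(\langle(\mu,s),w^{-1}\delta w\rangle-\tfrac12\langle\mu,\delta s\rangle+\Theta(\tilde v_{M_i},\tilde j_{M_i},\tilde u_{A_j},\tilde j_{A_j},\tilde u_{B_j},\tilde j_{B_j})\Big).$$ Moreover $[\tilde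 B_g,\tilde A_g^{-1}]\cdots[\tilde B_1,\tilde A_1^{-1}]\tilde M_n\cdots\tilde M_1=(e^{-\mu},-s)$ on $\mathcal C$, and this element lies in $T_{\mathfrak c}$ if $\mathfrak c$ is compatible with the decomposition $\mathfrak g\oplus\mathfrak g^*$, that is, if $(\xi,j)\in\mathfrak c$ implies $(\xi,0)\in\mathfrak c$. -/

import Mathlib

open scoped Manifold ContDiff Topology

noncomputable section

/-! ### Lie groups: Maurer-Cartan forms, one-parameter subgroups, adjoint action -/

section LieGroups

variable {F : Type*} [NormedAddCommGroup F] [NormedSpace ℝ F]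
  {M : Type*} [TopologicalSpace M] (J : ModelWithCorners ℝ F M)
  {K : Type*} [TopologicalSpace K] [ChartedSpace M K] [Group K]
  {E : Type*} [NormedAddCommGroup E] [NormedSpace ℝ E]

/-- `f⁻¹ δf` at the point `x`, for a family `f` of elements of a Lie group `K`: the derivative at
`x` of `y ↦ f(x)⁻¹ f(y)`. It takes values in the tangent space at `1`, whose underlying vector
space is the model space `F`. -/
def leftLog (f : E → K) (x : E) : E →L[ℝ] F :=
  mfderiv 𝓘(ℝ, E) J (fun y => (f x)⁻¹ * f y) x

/-- `δf f⁻¹` at the point `x`, for a family `f` of elements of a Lie group `K`: the derivative at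
`x` of `y ↦ f(y) f(x)⁻¹`. -/
def rightLog (f : E → K) (x : E) : E →L[ℝ] F :=
  mfderiv 𝓘(ℝ, E) J (fun y => f y * (f x)⁻¹) x

/-- `γ` is the one-parameter subgroup of the Lie group `K` with initial velocity `ξ`. -/
structure IsOneParamSubgroup (γ : ℝ → K) (ξ : F) : Prop where
  map_add : ∀ s t, γ (s + t) = γ s * γ t
  smooth : ContMDiff 𝓘(ℝ, ℝ) J ∞ γ
  velocity : (mfderiv 𝓘(ℝ, ℝ) J γ 0 : ℝ →L[ℝ] F) 1 = ξ

/-- The exponential map of a Lie group: the value at time `1` of the (unique) one-parameter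
subgroup with initial velocity `ξ`. -/
def lieExp (ξ : F) : K :=
  (Classical.epsilon fun γ : ℝ → K => IsOneParamSubgroup J γ ξ) 1

end LieGroups

instance : ENat.LEInfty (minSmoothness ℝ 3) := ⟨by
  rw [minSmoothness_of_isRCLikeNormedField]
  exact ENat.LEInfty.out⟩

section Semidirect

set_option linter.unusedSectionVars false

variable (V : Type*) [NormedAddCommGroup V] [NormedSpace ℝ V] [FiniteDimensional ℝ V]
  {G : Type*} [TopologicalSpace G] [ChartedSpace V G] [Group G] [LieGroup 𝓘(ℝ, V) ∞ G]

/-- The adjoint action of `g` on the Lie algebra `𝔤 = T₁G`, the derivative at `1` of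
`x ↦ g x g⁻¹`. The vector space underlying `𝔤` is the model space `V`. -/
def Ad (g : G) : V →L[ℝ] V :=
  mfderiv 𝓘(ℝ, V) 𝓘(ℝ, V) (fun x : G => g * x * g⁻¹) 1

theorem Ad_hasMFDerivAt (g : G) :
    HasMFDerivAt 𝓘(ℝ, V) 𝓘(ℝ, V) (fun x : G => g * x * g⁻¹) 1 (Ad V g) := by
  have h : ContMDiff 𝓘(ℝ, V) 𝓘(ℝ, V) ∞ (fun x : G => g * x * g⁻¹) :=
    (contMDiff_const.mul contMDiff_id).mul contMDiff_const
  exact (h.mdifferentiableAt (by simp)).hasMFDerivAt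

theorem Ad_one : Ad V (1 : G) = ContinuousLinearMap.id ℝ V := by
  have h : (fun x : G => (1 : G) * x * (1 : G)⁻¹) = id := by ext x; simp
  unfold Ad
  rw [h]
  exact mfderiv_id

theorem Ad_mul (g h : G) : Ad V (g * h) = (Ad V g).comp (Ad V h) := by
  have hc : (fun x : G => g * h * x * (g * h)⁻¹)
      = (fun x : G => g * x * g⁻¹) ∘ (fun x : G => h * x * h⁻¹) := by
    ext x; simp [mul_assoc]
  have h1 := Ad_hasMFDerivAt V h
  have h2 : HasMFDerivAt 𝓘(ℝ, V) 𝓘(ℝ, V) (fun x : G => g * x * g⁻¹) (h * 1 * h⁻¹)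
      (Ad V g) := by
    have e : h * 1 * h⁻¹ = 1 := by simp
    rw [e]
    exact Ad_hasMFDerivAt V g
  have h3 := HasMFDerivAt.comp (I' := 𝓘(ℝ, V)) (1 : G) h2 h1
  have h4 := Ad_hasMFDerivAt V (g * h)
  rw [hc] at h4
  exact hasMFDerivAt_unique h4 h3

/-- `Ad*(g)`, the algebraic dual of `Ad(g)`: `⟨Ad*(g) j, ξ⟩ = ⟨j, Ad(g) ξ⟩`. -/
def coAd (g : G) (j : StrongDual ℝ V) : StrongDual ℝ V := j.comp (Ad V g)

variable (G)

/-- The group `G ⋉ 𝔤*`; as a manifold it is the product `G × 𝔤*`. -/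
def CoadjGroup : Type _ := G × StrongDual ℝ V

namespace CoadjGroup

/-- The model with corners of `G ⋉ 𝔤*`. -/
abbrev model := (𝓘(ℝ, V)).prod 𝓘(ℝ, StrongDual ℝ V)

instance : TopologicalSpace (CoadjGroup V G) :=
  inferInstanceAs (TopologicalSpace (G × StrongDual ℝ V))

instance : ChartedSpace (ModelProd V (StrongDual ℝ V)) (CoadjGroup V G) :=
  inferInstanceAs (ChartedSpace (ModelProd V (StrongDual ℝ V)) (G × StrongDual ℝ V))

variable {G}

/-- The element `(u, a)`. -/
def mk (u : G) (a : StrongDual ℝ V) : CoadjGroup V G := (u, a)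

variable (G)

/-- `(u₁, a₁) (u₂, a₂) = (u₁ u₂, a₁ + Ad*(u₁⁻¹) a₂)`. -/
instance : Mul (CoadjGroup V G) := ⟨fun p q => mk V (p.1 * q.1) (p.2 + coAd V p.1⁻¹ q.2)⟩

instance : One (CoadjGroup V G) := ⟨mk V 1 0⟩

instance : Inv (CoadjGroup V G) := ⟨fun p => mk V p.1⁻¹ (-coAd V p.1 p.2)⟩

instance : Group (CoadjGroup V G) :=
  Group.ofLeftAxioms
    (fun p q r => Prod.ext (mul_assoc p.1 q.1 r.1) (by
      change p.2 + coAd V p.1⁻¹ q.2 + coAd V (p.1 * q.1)⁻¹ r.2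
        = p.2 + coAd V p.1⁻¹ (q.2 + coAd V q.1⁻¹ r.2)
      ext v
      simp [coAd, Ad_mul, add_assoc]))
    (fun p => Prod.ext (one_mul p.1) (by
      change (0 : StrongDual ℝ V) + coAd V (1 : G)⁻¹ p.2 = p.2
      ext v
      simp [coAd, Ad_one]))
    (fun p => Prod.ext (inv_mul_cancel p.1) (by
      change -coAd V p.1 p.2 + coAd V (p.1⁻¹)⁻¹ p.2 = (0 : StrongDual ℝ V)
      simp))

variable {G}

/-- The `𝔤*`-valued coordinate `j` of `(u, a) = (u, -Ad*(u⁻¹) j)`. -/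
def j {V : Type*} [NormedAddCommGroup V] [NormedSpace ℝ V] [FiniteDimensional ℝ V] {G : Type*}
    [TopologicalSpace G] [ChartedSpace V G] [Group G] [LieGroup 𝓘(ℝ, V) ∞ G]
    (p : CoadjGroup V G) : StrongDual ℝ V :=
  -coAd V p.1 p.2

theorem eq_mk_j (p : CoadjGroup V G) : p = mk V p.1 (-coAd V p.1⁻¹ p.j) := by
  refine Prod.ext rfl ?_
  change p.2 = -coAd V p.1⁻¹ (-coAd V p.1 p.2)
  have h : (Ad V p.1).comp (Ad V p.1⁻¹) = ContinuousLinearMap.id ℝ V := by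
    rw [← Ad_mul, mul_inv_cancel, Ad_one]
  simp [coAd, ContinuousLinearMap.comp_assoc, h]

end CoadjGroup

variable {V}

/-- The Lie bracket of `𝔤` (Mathlib's bracket of left-invariant vector fields). -/
def lieBr (x y : V) : V :=
  @Bracket.bracket (GroupLieAlgebra 𝓘(ℝ, V) G) (GroupLieAlgebra 𝓘(ℝ, V) G) _ x y

theorem lieBr_add (x y z : V) : lieBr G x (y + z) = lieBr G x y + lieBr G x z :=
  @lie_add (GroupLieAlgebra 𝓘(ℝ, V) G) (GroupLieAlgebra 𝓘(ℝ, V) G) _ _ _ x y z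

theorem lieBr_smul (c : ℝ) (x y : V) : lieBr G x (c • y) = c • lieBr G x y :=
  lie_smul (L := GroupLieAlgebra 𝓘(ℝ, V) G) (M := GroupLieAlgebra 𝓘(ℝ, V) G) c x y

theorem add_lieBr (x y z : V) : lieBr G (x + y) z = lieBr G x z + lieBr G y z :=
  @add_lie (GroupLieAlgebra 𝓘(ℝ, V) G) (GroupLieAlgebra 𝓘(ℝ, V) G) _ _ _ x y z

theorem smul_lieBr (c : ℝ) (x y : V) : lieBr G (c • x) y = c • lieBr G x y :=
  smul_lie (L := GroupLieAlgebra 𝓘(ℝ, V) G) (M := GroupLieAlgebra 𝓘(ℝ, V) G) c x y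

theorem lieBr_self (x : V) : lieBr G x x = 0 :=
  @lie_self (GroupLieAlgebra 𝓘(ℝ, V) G) _ x

theorem lieBr_leibniz (x y z : V) :
    lieBr G x (lieBr G y z) = lieBr G (lieBr G x y) z + lieBr G y (lieBr G x z) :=
  @leibniz_lie (GroupLieAlgebra 𝓘(ℝ, V) G) (GroupLieAlgebra 𝓘(ℝ, V) G)
    (GroupLieAlgebra 𝓘(ℝ, V) G) _ _ _ _ _ x y z

theorem lieBr_skew (x y : V) : lieBr G x y = -lieBr G y x :=
  (@lie_skew (GroupLieAlgebra 𝓘(ℝ, V) G) _ x y).symm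

/-- `ad x = [x, ·]` on `𝔤`. -/
def lieAd (x : V) : V →L[ℝ] V :=
  LinearMap.toContinuousLinearMap
    { toFun := lieBr G x
      map_add' := lieBr_add G x
      map_smul' := fun c y => lieBr_smul G c x y }

theorem lieAd_apply (x y : V) : lieAd G x y = lieBr G x y := rfl

end Semidirect

section Algebra

variable (V : Type*) [NormedAddCommGroup V] [NormedSpace ℝ V]

/-- The vector space `𝔤 ⊕ 𝔤*` underlying the Lie algebra of `G ⋉ 𝔤*`. -/
@[nolint unusedArguments]
def CoadjAlg (_G : Type*) : Type _ := V × StrongDual ℝ V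

namespace CoadjAlg

variable (G : Type*)

instance : NormedAddCommGroup (CoadjAlg V G) :=
  inferInstanceAs (NormedAddCommGroup (V × StrongDual ℝ V))

instance : NormedSpace ℝ (CoadjAlg V G) :=
  inferInstanceAs (NormedSpace ℝ (V × StrongDual ℝ V))

variable [FiniteDimensional ℝ V] [TopologicalSpace G] [ChartedSpace V G] [Group G]
  [LieGroup 𝓘(ℝ, V) ∞ G]

/-- `[(ξ, j), (η, k)] = ([ξ, η], ad*_ξ k - ad*_η j)` with the coadjoint action
`ad*_ξ k = -k ∘ ad ξ`. -/
instance : Bracket (CoadjAlg V G) (CoadjAlg V G) :=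
  ⟨fun p q => (lieBr G p.1 q.1, p.2.comp (lieAd G q.1) - q.2.comp (lieAd G p.1))⟩

theorem bracket_def (p q : CoadjAlg V G) : ⁅p, q⁆ =
    ((lieBr G p.1 q.1, p.2.comp (lieAd G q.1) - q.2.comp (lieAd G p.1)) : V × StrongDual ℝ V) :=
  rfl

instance : LieRing (CoadjAlg V G) where
  add_lie p q r := by
    refine Prod.ext (add_lieBr G p.1 q.1 r.1) ?_
    change (p.2 + q.2).comp (lieAd G r.1) - r.2.comp (lieAd G (p.1 + q.1))
      = (p.2.comp (lieAd G r.1) - r.2.comp (lieAd G p.1))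
        + (q.2.comp (lieAd G r.1) - r.2.comp (lieAd G q.1))
    ext v
    simp [lieAd_apply, add_lieBr]
    ring
  lie_add p q r := by
    refine Prod.ext (lieBr_add G p.1 q.1 r.1) ?_
    change p.2.comp (lieAd G (q.1 + r.1)) - (q.2 + r.2).comp (lieAd G p.1)
      = (p.2.comp (lieAd G q.1) - q.2.comp (lieAd G p.1))
        + (p.2.comp (lieAd G r.1) - r.2.comp (lieAd G p.1))
    ext v
    simp [lieAd_apply, add_lieBr]
    ring
  lie_self p := by
    refine Prod.ext (lieBr_self G p.1) ?_
    change p.2.comp (lieAd G p.1) - p.2.comp (lieAd G p.1) = 0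
    simp
  leibniz_lie p q r := by
    refine Prod.ext (lieBr_leibniz G p.1 q.1 r.1) ?_
    change p.2.comp (lieAd G (lieBr G q.1 r.1))
        - (q.2.comp (lieAd G r.1) - r.2.comp (lieAd G q.1)).comp (lieAd G p.1)
      = ((p.2.comp (lieAd G q.1) - q.2.comp (lieAd G p.1)).comp (lieAd G r.1)
          - r.2.comp (lieAd G (lieBr G p.1 q.1)))
        + (q.2.comp (lieAd G (lieBr G p.1 r.1))
          - (p.2.comp (lieAd G r.1) - r.2.comp (lieAd G p.1)).comp (lieAd G q.1))
    ext v
    simp only [sub_apply, add_apply, ContinuousLinearMap.comp_apply, lieAd_apply]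
    have h1 := congrArg p.2 (lieBr_leibniz G q.1 r.1 v)
    have h2 := congrArg r.2 (lieBr_leibniz G p.1 q.1 v)
    have h3 := congrArg q.2 (lieBr_leibniz G p.1 r.1 v)
    rw [map_add] at h1 h2 h3
    linarith

instance : LieAlgebra ℝ (CoadjAlg V G) where
  lie_smul c p q := by
    refine Prod.ext (lieBr_smul G c p.1 q.1) ?_
    change p.2.comp (lieAd G (c • q.1)) - (c • q.2).comp (lieAd G p.1)
      = c • (p.2.comp (lieAd G q.1) - q.2.comp (lieAd G p.1))
    ext v
    simp [lieAd_apply, smul_lieBr]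
    ring

variable {V G}

/-- The invariant symmetric pairing `⟨(ξ, j), (η, k)⟩ = ⟨j, η⟩ + ⟨k, ξ⟩`, as a linear form in the
second argument. -/
def pairing (p : CoadjAlg V G) : V × StrongDual ℝ V →L[ℝ] ℝ :=
  (p.2 : V →L[ℝ] ℝ).coprod (ContinuousLinearMap.apply ℝ ℝ p.1)

end CoadjAlg

end Algebra

/-! ### The extended phase space -/

section PhaseSpace

variable {V : Type*} [NormedAddCommGroup V] [NormedSpace ℝ V] [FiniteDimensional ℝ V]
  {G : Type*} [TopologicalSpace G] [ChartedSpace V G] [Group G] [LieGroup 𝓘(ℝ, V) ∞ G]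

/-- The product `x_{m-1} ⋯ x_1 x_0` of the first `m` entries of a finite family, in decreasing
order of the index. -/
def descProd {K : Type*} [Group K] {N : ℕ} (x : Fin N → K) (m : ℕ) : K :=
  ((List.ofFn x).take m).reverse.prod

/-- The element `(e^{-μ}, -s)` of `G ⋉ 𝔤*` for `D = (μ, s)`. -/
def expNeg (D : CoadjAlg V G) : CoadjGroup V G :=
  CoadjGroup.mk V (lieExp 𝓘(ℝ, V) (-D.1)) (-D.2)

/-- The subgroup `T_𝔠` obtained by exponentiating a subalgebra `𝔠` of `𝔤 ⊕ 𝔤*`. -/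
def cartanSubgroup (c : LieSubalgebra ℝ (CoadjAlg V G)) : Subgroup (CoadjGroup V G) :=
  Subgroup.closure {h | ∃ ξ ∈ c, ∃ γ : ℝ → CoadjGroup V G,
    IsOneParamSubgroup (CoadjGroup.model V) γ (ξ : V × StrongDual ℝ V) ∧ γ 1 = h}

/-- The variables of the theory for `n` ordinary punctures, `g` handles and one distinguished
puncture: the group elements `(v_{M_i}, x_{M_i})`, the holonomies `A_j`, `B_j` of the handles, the
group element `g_∞ = (v_∞, x_∞)`, the group element `w` and the element `D = (μ, s)` of the
Cartan subalgebra `𝔠`. -/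
structure ExtPhase (n g : ℕ) (c : LieSubalgebra ℝ (CoadjAlg V G)) where
  /-- `(v_{M_i}, x_{M_i})` -/
  gM : Fin n → CoadjGroup V G
  /-- `A_j` -/
  A : Fin g → CoadjGroup V G
  /-- `B_j` -/
  B : Fin g → CoadjGroup V G
  /-- `g_∞ = (v_∞, x_∞)` -/
  gInf : CoadjGroup V G
  /-- `w` -/
  w : CoadjGroup V G
  /-- `(μ, s)` -/
  D : c

namespace ExtPhase

variable {n g : ℕ} {c : LieSubalgebra ℝ (CoadjAlg V G)} (D₀ : Fin n → CoadjAlg V G)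

/-- The holonomies of the ordinary punctures,
`M_i = (v_{M_i}, x_{M_i}) (e^{-μ_i}, -s_i) (v_{M_i}, x_{M_i})⁻¹` with `D₀ i = (μ_i, s_i)` fixed. -/
def M (p : ExtPhase n g c) (i : Fin n) : CoadjGroup V G :=
  p.gM i * expNeg (D₀ i) * (p.gM i)⁻¹

end ExtPhase

/-- `[B_g, A_g⁻¹] ⋯ [B_1, A_1⁻¹] M_n ⋯ M_1`, where `[b, a] = b a b⁻¹ a⁻¹`. -/
def totalHol {K : Type*} [Group K] {n g : ℕ} (M : Fin n → K) (A B : Fin g → K) : K :=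
  descProd (fun i => B i * (A i)⁻¹ * (B i)⁻¹ * A i) g * descProd M n

namespace ExtPhase

variable {n g : ℕ} {c : LieSubalgebra ℝ (CoadjAlg V G)} (D₀ : Fin n → CoadjAlg V G)

/-- `K_{n+2g}⁻¹ = [B_g, A_g⁻¹] ⋯ [B_1, A_1⁻¹] M_n ⋯ M_1`. -/
def invK (p : ExtPhase n g c) : CoadjGroup V G := totalHol (p.M D₀) p.A p.B

/-- The constraint surface `K_{n+2g}⁻¹ = g_∞ (e^{-μ}, -s) g_∞⁻¹`. -/
def constraintSurface : Set (ExtPhase n g c) :=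
  {p | p.invK D₀ = p.gInf * expNeg (p.D : CoadjAlg V G) * p.gInf⁻¹}

/-- The action of `h`: left multiplication of the `(v_{M_i}, x_{M_i})` and of `g_∞`, conjugation of
the `A_j`, `B_j`, while `w` and `(μ, s)` are unchanged. -/
def gauge (h : CoadjGroup V G) (p : ExtPhase n g c) : ExtPhase n g c where
  gM i := h * p.gM i
  A i := h * p.A i * h⁻¹
  B i := h * p.B i * h⁻¹
  gInf := h * p.gInf
  w := p.w
  D := p.D

end ExtPhase

/-! ### Smooth families and differential forms

A differential form on the constraint surface, which need not be a manifold everywhere, is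
described by its pull-backs along all smooth families of points of the surface, parametrised by
open subsets of finite-dimensional vector spaces. Wherever the surface is a submanifold, its local
parametrisations are such families. -/

section Families

variable {E : Type*} [NormedAddCommGroup E] [NormedSpace ℝ E]

/-- The exterior derivative of a one-form on a vector space. -/
def extD (θ : E → E →L[ℝ] ℝ) (x : E) : E [⋀^Fin 2]→L[ℝ] ℝ :=
  extDeriv (fun y => ContinuousAlternatingMap.ofSubsingleton ℝ E ℝ (0 : Fin 1) (θ y)) x

variable {n g : ℕ} {c : LieSubalgebra ℝ (CoadjAlg V G)} (D₀ : Fin n → CoadjAlg V G)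

/-- `φ` is a smooth family of points of the extended phase space, with parameter in `U`. -/
structure IsSmoothFamily (U : Set E) (φ : E → ExtPhase n g c) : Prop where
  gM : ∀ i, ContMDiffOn 𝓘(ℝ, E) (CoadjGroup.model V) ∞ (fun x => (φ x).gM i) U
  A : ∀ i, ContMDiffOn 𝓘(ℝ, E) (CoadjGroup.model V) ∞ (fun x => (φ x).A i) U
  B : ∀ i, ContMDiffOn 𝓘(ℝ, E) (CoadjGroup.model V) ∞ (fun x => (φ x).B i) U
  gInf : ContMDiffOn 𝓘(ℝ, E) (CoadjGroup.model V) ∞ (fun x => (φ x).gInf) U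
  w : ContMDiffOn 𝓘(ℝ, E) (CoadjGroup.model V) ∞ (fun x => (φ x).w) U
  D : ContDiffOn ℝ ∞ (fun x => ((φ x).D : CoadjAlg V G)) U

/-- The one-form `Θ(v_{M_i}, j_{M_i}, u_{A_j}, j_{A_j}, u_{B_j}, j_{B_j})` of a family of elements
`v_i` of `G` and `M_i`, `A_j`, `B_j` of `G ⋉ 𝔤*`, where each of the latter is written as
`(u, -Ad*(u⁻¹) j)`. With `P i = u_{H_{i-1}} ⋯ u_{H_1} u_{M_n} ⋯ u_{M_1}` and
`u_{H_i} = [u_{B_i}, u_{A_i}⁻¹]`, and with `δ^r f = δf f⁻¹`, it is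
`∑ ⟨j_{M_i}, δ^r (u_{M_{i-1}} ⋯ u_{M_1}) - δ^r v_i⟩`
`+ ∑ ⟨j_{A_i}, δ^r P_i - δ^r (u_{A_i}⁻¹ u_{B_i}⁻¹ u_{A_i} P_i)⟩`
`+ ∑ ⟨j_{B_i}, δ^r (u_{A_i}⁻¹ u_{B_i}⁻¹ u_{A_i} P_i) - δ^r (u_{B_i}⁻¹ u_{A_i} P_i)⟩`. -/
def Theta (v : Fin n → E → G) (M : Fin n → E → CoadjGroup V G)
    (A B : Fin g → E → CoadjGroup V G) (x : E) : E →L[ℝ] ℝ :=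
  let uA : Fin g → E → G := fun i y => (A i y).1
  let uB : Fin g → E → G := fun i y => (B i y).1
  let U : Fin n → E → G := fun i y => descProd (fun k => (M k y).1) i
  let P : Fin g → E → G := fun i y =>
    descProd (fun k => uB k y * (uA k y)⁻¹ * (uB k y)⁻¹ * uA k y) i * descProd (fun k => (M k y).1) n
  let Q : Fin g → E → G := fun i y => (uA i y)⁻¹ * (uB i y)⁻¹ * uA i y * P i y
  let R : Fin g → E → G := fun i y => (uB i y)⁻¹ * uA i y * P i y
  let δr : (E → G) → E →L[ℝ] V := fun f => rightLog 𝓘(ℝ, V) f x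
  ∑ i, (M i x).j.comp (δr (U i) - δr (v i))
    + ∑ i, (A i x).j.comp (δr (P i) - δr (Q i))
    + ∑ i, (B i x).j.comp (δr (Q i) - δr (R i))

/-- The one-form `⟨(μ, s), w⁻¹ δw⟩` along the family `φ`. -/
def wForm (φ : E → ExtPhase n g c) (x : E) : E →L[ℝ] ℝ :=
  (CoadjAlg.pairing ((φ x).D : CoadjAlg V G)).comp
    (leftLog (CoadjGroup.model V) (fun y => (φ y).w) x)

/-- The `𝔤`-valued one-form `δμ` along the family `φ`. -/
def dMu (φ : E → ExtPhase n g c) (x : E) : E →L[ℝ] V :=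
  fderiv ℝ (fun y => ((φ y).D : CoadjAlg V G).1) x

/-- The `𝔤*`-valued one-form `δs` along the family `φ`. -/
def dS (φ : E → ExtPhase n g c) (x : E) : E →L[ℝ] StrongDual ℝ V :=
  fderiv ℝ (fun y => ((φ y).D : CoadjAlg V G).2) x

/-- The symplectic potential
`⟨(μ, s), w⁻¹δw⟩ + Θ + ⟨j_{K_{n+2g}}, δv_∞ v_∞⁻¹⟩ - ⟨Ad*(v_∞) x_∞ - s/2, δμ⟩`
along the family `φ`. -/
def potential (φ : E → ExtPhase n g c) (x : E) : E →L[ℝ] ℝ :=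
  wForm φ x
    + Theta (fun i y => ((φ y).gM i).1) (fun i y => (φ y).M D₀ i) (fun i y => (φ y).A i)
        (fun i y => (φ y).B i) x
    + ((φ x).invK D₀).j.comp (rightLog 𝓘(ℝ, V) (fun y => (φ y).gInf.1) x)
    - (coAd V (φ x).gInf.1 (φ x).gInf.2 - (1 / 2 : ℝ) • ((φ x).D : CoadjAlg V G).2).comp (dMu φ x)

/-- The two-form `Ω = (k / 2π) δ(potential)` along the family `φ`. -/
def Omega (k : ℝ) (φ : E → ExtPhase n g c) (x : E) : E [⋀^Fin 2]→L[ℝ] ℝ :=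
  (k / (2 * Real.pi)) • extD (potential D₀ φ) x

/-- The potential in the conjugated variables `X̃ = g_∞⁻¹ X g_∞` for `X = M_i, A_j, B_j` and
`ṽ_{M_i} = v_∞⁻¹ v_{M_i}`:  `⟨(μ, s), w⁻¹δw⟩ - ⟨μ, δs⟩/2 + Θ(ṽ, M̃, Ã, B̃)`. -/
def fixedPotential (φ : E → ExtPhase n g c) (x : E) : E →L[ℝ] ℝ :=
  wForm φ x
    - (1 / 2 : ℝ) • (ContinuousLinearMap.apply ℝ ℝ ((φ x).D : CoadjAlg V G).1).comp (dS φ x)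
    + Theta (fun i y => (φ y).gInf.1⁻¹ * ((φ y).gM i).1)
        (fun i y => (φ y).gInf⁻¹ * (φ y).M D₀ i * (φ y).gInf)
        (fun i y => (φ y).gInf⁻¹ * (φ y).A i * (φ y).gInf)
        (fun i y => (φ y).gInf⁻¹ * (φ y).B i * (φ y).gInf) x

end Families

end PhaseSpace

end

/-!
Everything reduces to a field-dependent conjugation formula for the one-form `Θ`. Write
`δʳf = δf f⁻¹` and, for a family `h` of elements of `G ⋉ 𝔤*` with `G`-component `u`, put
`λ = u⁻¹δu`. The coordinate `j` is a cocycle, `j_{XY} = j_X ∘ Ad(u_Y) + j_Y` (`j_mul_apply`), and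
conjugation by `u` turns `δʳf` into `Ad(u)(λ + δʳf - Ad(f)λ)` (`rightLog_conj`). With these two
rules each puncture and each handle changes its contribution to `Θ` by an explicit term
(`puncture_term_conj`, `handle_term_conj`), and these terms telescope along the ordered product of
all holonomies. What is left is `Θ ↦ Θ + ⟨j_h, δʳK - Ad(K)λ + λ⟩ - ⟨j_K, λ⟩`, which involves nothing
but the total holonomy `K` (`Theta_conj`).

On the constraint surface `u_K = v_∞ e^{-μ} v_∞⁻¹`, hence
`δʳK = δʳv_∞ - Ad(v_∞) δμ - Ad(K) δʳv_∞` provided that `δ(e^{-μ}) e^{μ} = -δμ`. With this value the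
change of `Θ` cancels against the change of the two terms involving `g_∞`, so that the symplectic
potential itself, not only its exterior derivative, is invariant (`potential_gauge`). This gives
all statements about `Ω`. It is invariant because its potential is. It annihilates the
infinitesimal transformations because the potential of the family `(t, x) ↦ γ(t)·φ(x)` equals that
of `(t, x) ↦ φ(x)`, which is pulled back along the projection to the second variable. The choice
`h = g_∞⁻¹` makes `g_∞` trivial, and the potential becomes the one in the conjugated variables plus
the exact form `δ⟨s, μ⟩ / 2`.

The formula `δ(e^{-μ}) e^{μ} = -δμ` holds because `𝔠` is abelian: elements of `𝔤` with vanishing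
bracket have commuting one-parameter subgroups, so that `exp` is additive on the projection of
`𝔠` to `𝔤`. For this the one-parameter subgroups are constructed as integral curves of
left-invariant vector fields, and commuting elements are handled through the derivative of
`t ↦ Ad(γ(t))`, which is expressed by the bracket by a computation in a chart at `1`.
-/

noncomputable section

/-! ### Calculus of logarithmic derivatives -/

section LogDerivative

set_option linter.unusedSectionVars false

variable {V : Type*} [NormedAddCommGroup V] [NormedSpace ℝ V]
  {G : Type*} [TopologicalSpace G] [ChartedSpace V G] [Group G] [LieGroup 𝓘(ℝ, V) ∞ G]
  {E : Type*} [NormedAddCommGroup E] [NormedSpace ℝ E]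

/-- At the identity the derivative of the multiplication is the addition. -/
theorem hasMFDerivAt_mul_of_eq_one {f g : E → G} {x : E} {f' g' : E →L[ℝ] V}
    (hf : HasMFDerivAt 𝓘(ℝ, E) 𝓘(ℝ, V) f x f') (hg : HasMFDerivAt 𝓘(ℝ, E) 𝓘(ℝ, V) g x g')
    (hfx : f x = 1) (hgx : g x = 1) :
    HasMFDerivAt 𝓘(ℝ, E) 𝓘(ℝ, V) (fun y => f y * g y) x (f' + g') := by
  have hm : MDifferentiableAt ((𝓘(ℝ, V)).prod 𝓘(ℝ, V)) 𝓘(ℝ, V) (fun p : G × G => p.1 * p.2)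
      (f x, g x) := (contMDiff_mul 𝓘(ℝ, V) ∞).mdifferentiableAt (by simp)
  have h := hm.hasMFDerivAt.comp x (hf.prodMk hg)
  refine h.congr_mfderiv ?_
  ext v
  refine (mfderiv_prod_eq_add_apply (v := (f' v, g' v)) hm).trans ?_
  have e1 : (fun z : G => z * g x) = id := by ext z; simp [hgx]
  have e2 : (fun z : G => f x * z) = id := by ext z; simp [hfx]
  have h1 : (mfderiv 𝓘(ℝ, V) 𝓘(ℝ, V) (fun z : G => z * g x) (f x) : V →L[ℝ] V)
      = ContinuousLinearMap.id ℝ V := by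
    rw [e1]; exact mfderiv_id
  have h2 : (mfderiv 𝓘(ℝ, V) 𝓘(ℝ, V) (fun z : G => f x * z) (g x) : V →L[ℝ] V)
      = ContinuousLinearMap.id ℝ V := by
    rw [e2]; exact mfderiv_id
  exact congrArg₂ (· + ·) (DFunLike.congr_fun h1 (f' v)) (DFunLike.congr_fun h2 (g' v))

theorem hasMFDerivAt_conj (u : G) {f : E → G} {x : E} {f' : E →L[ℝ] V} [FiniteDimensional ℝ V]
    (hf : HasMFDerivAt 𝓘(ℝ, E) 𝓘(ℝ, V) f x f') (hfx : f x = 1) :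
    HasMFDerivAt 𝓘(ℝ, E) 𝓘(ℝ, V) (fun y => u * f y * u⁻¹) x ((Ad V u).comp f') := by
  have h := Ad_hasMFDerivAt V u
  rw [← hfx] at h
  exact h.comp x hf

theorem mdifferentiableAt_mul {f g : E → G} {x : E}
    (hf : MDifferentiableAt 𝓘(ℝ, E) 𝓘(ℝ, V) f x) (hg : MDifferentiableAt 𝓘(ℝ, E) 𝓘(ℝ, V) g x) :
    MDifferentiableAt 𝓘(ℝ, E) 𝓘(ℝ, V) (fun y => f y * g y) x := by
  have hm : MDifferentiableAt ((𝓘(ℝ, V)).prod 𝓘(ℝ, V)) 𝓘(ℝ, V) (fun p : G × G => p.1 * p.2)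
      (f x, g x) := (contMDiff_mul 𝓘(ℝ, V) ∞).mdifferentiableAt (by simp)
  exact hm.comp x (hf.prodMk hg)

theorem mdifferentiableAt_inv {f : E → G} {x : E}
    (hf : MDifferentiableAt 𝓘(ℝ, E) 𝓘(ℝ, V) f x) :
    MDifferentiableAt 𝓘(ℝ, E) 𝓘(ℝ, V) (fun y => (f y)⁻¹) x := by
  have hm : MDifferentiableAt 𝓘(ℝ, V) 𝓘(ℝ, V) (fun p : G => p⁻¹) (f x) :=
    (contMDiff_inv 𝓘(ℝ, V) ∞).mdifferentiableAt (by simp)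
  exact hm.comp x hf

theorem hasMFDerivAt_rightLog {f : E → G} {x : E}
    (hf : MDifferentiableAt 𝓘(ℝ, E) 𝓘(ℝ, V) f x) :
    HasMFDerivAt 𝓘(ℝ, E) 𝓘(ℝ, V) (fun y => f y * (f x)⁻¹) x
      (rightLog (E := E) 𝓘(ℝ, V) f x) := by
  have h : MDifferentiableAt 𝓘(ℝ, E) 𝓘(ℝ, V) (fun y => f y * (f x)⁻¹) x :=
    mdifferentiableAt_mul hf mdifferentiableAt_const
  exact h.hasMFDerivAt

theorem rightLog_eq_of_hasMFDerivAt {f : E → G} {x : E} {f' : E →L[ℝ] V}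
    (h : HasMFDerivAt 𝓘(ℝ, E) 𝓘(ℝ, V) (fun y => f y * (f x)⁻¹) x f') :
    rightLog 𝓘(ℝ, V) f x = f' :=
  h.mfderiv

theorem rightLog_congr {f g : E → G} {x : E} (h : f =ᶠ[𝓝 x] g) :
    rightLog 𝓘(ℝ, V) f x = rightLog 𝓘(ℝ, V) g x := by
  have h2 : (fun y => f y * (f x)⁻¹) =ᶠ[𝓝 x] fun y => g y * (g x)⁻¹ := by
    filter_upwards [h] with y hy
    rw [hy, h.self_of_nhds]
  exact h2.mfderiv_eq

theorem rightLog_const (a : G) (x : E) :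
    rightLog 𝓘(ℝ, V) (fun _ : E => a) x = 0 :=
  rightLog_eq_of_hasMFDerivAt (hasMFDerivAt_const _ _)

variable [FiniteDimensional ℝ V]

theorem rightLog_mul {f g : E → G} {x : E}
    (hf : MDifferentiableAt 𝓘(ℝ, E) 𝓘(ℝ, V) f x) (hg : MDifferentiableAt 𝓘(ℝ, E) 𝓘(ℝ, V) g x) :
    rightLog 𝓘(ℝ, V) (fun y => f y * g y) x
      = rightLog 𝓘(ℝ, V) f x + (Ad V (f x)).comp (rightLog 𝓘(ℝ, V) g x) := by
  apply rightLog_eq_of_hasMFDerivAt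
  have h := hasMFDerivAt_mul_of_eq_one (hasMFDerivAt_rightLog hf)
    (hasMFDerivAt_conj (f x) (hasMFDerivAt_rightLog hg) (by simp)) (by simp) (by simp)
  refine h.congr_of_eventuallyEq (Filter.Eventually.of_forall fun y => ?_)
  simp [mul_assoc]

theorem Ad_comp_Ad_inv (u : G) : (Ad V u).comp (Ad V u⁻¹) = ContinuousLinearMap.id ℝ V := by
  rw [← Ad_mul, mul_inv_cancel, Ad_one]

theorem Ad_inv_comp_Ad (u : G) : (Ad V u⁻¹).comp (Ad V u) = ContinuousLinearMap.id ℝ V := by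
  rw [← Ad_mul, inv_mul_cancel, Ad_one]

@[simp] theorem Ad_inv_apply_Ad (u : G) (v : V) : Ad V u⁻¹ (Ad V u v) = v :=
  DFunLike.congr_fun (Ad_inv_comp_Ad u) v

@[simp] theorem Ad_apply_Ad_inv (u : G) (v : V) : Ad V u (Ad V u⁻¹ v) = v :=
  DFunLike.congr_fun (Ad_comp_Ad_inv u) v

theorem Ad_mul_apply (u w : G) (v : V) : Ad V (u * w) v = Ad V u (Ad V w v) := by
  rw [Ad_mul]; rfl

theorem Ad_one_apply (v : V) : Ad V (1 : G) v = v := by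
  rw [Ad_one]; rfl

theorem rightLog_inv {f : E → G} {x : E} (hf : MDifferentiableAt 𝓘(ℝ, E) 𝓘(ℝ, V) f x) :
    rightLog 𝓘(ℝ, V) (fun y => (f y)⁻¹) x
      = -(Ad V (f x)⁻¹).comp (rightLog 𝓘(ℝ, V) f x) := by
  have h := rightLog_mul (mdifferentiableAt_inv hf) hf
  simp only [inv_mul_cancel] at h
  rw [rightLog_const] at h
  exact eq_neg_of_add_eq_zero_left h.symm

end LogDerivative

/-! ### The group operations in a chart at the identity -/

section ChartAtOne

set_option linter.unusedSectionVars false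

open Set VectorField

variable {V : Type*} [NormedAddCommGroup V] [NormedSpace ℝ V] [FiniteDimensional ℝ V]
  {G : Type*} [TopologicalSpace G] [ChartedSpace V G] [Group G] [LieGroup 𝓘(ℝ, V) ∞ G]

variable (V G) in
/-- The preferred chart of the Lie group at the identity, as a map into the model space. -/
abbrev oneChart : PartialEquiv G V := extChartAt 𝓘(ℝ, V) (1 : G)

variable (V G) in
/-- The multiplication read in the chart at the identity. -/
def chartMul (p : V × V) : V :=
  oneChart V G ((oneChart V G).symm p.1 * (oneChart V G).symm p.2)

variable (V G) in
/-- The conjugation `(a, b) ↦ a b a⁻¹` read in the chart at the identity. -/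
def chartConj (p : V × V) : V :=
  oneChart V G ((oneChart V G).symm p.1 * (oneChart V G).symm p.2 * ((oneChart V G).symm p.1)⁻¹)

theorem one_mem_source : (1 : G) ∈ (oneChart V G).source := mem_extChartAt_source _

theorem oneChart_one_mem_target : oneChart V G 1 ∈ (oneChart V G).target :=
  mem_extChartAt_target _

@[simp] theorem oneChart_symm_one : (oneChart V G).symm (oneChart V G 1) = 1 :=
  extChartAt_to_inv _

theorem contMDiffAt_oneChart {g : G} (hg : g ∈ (oneChart V G).source) :
    ContMDiffAt 𝓘(ℝ, V) 𝓘(ℝ, V) ∞ (oneChart V G) g :=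
  contMDiffAt_extChartAt' (by rwa [extChartAt_source] at hg)

theorem contMDiffAt_oneChart_symm {x : V} (hx : x ∈ (oneChart V G).target) :
    ContMDiffAt 𝓘(ℝ, V) 𝓘(ℝ, V) ∞ (oneChart V G).symm x :=
  (contMDiffOn_extChartAt_symm (1 : G)).contMDiffAt ((isOpen_extChartAt_target _).mem_nhds hx)

theorem contDiffAt_chartMul {p : V × V} (h1 : p.1 ∈ (oneChart V G).target)
    (h2 : p.2 ∈ (oneChart V G).target)
    (h3 : (oneChart V G).symm p.1 * (oneChart V G).symm p.2 ∈ (oneChart V G).source) :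
    ContDiffAt ℝ ∞ (chartMul V G) p := by
  rw [← contMDiffAt_iff_contDiffAt]
  have e1 : ContMDiffAt 𝓘(ℝ, V × V) 𝓘(ℝ, V) ∞ (fun p : V × V => (oneChart V G).symm p.1) p :=
    (contMDiffAt_oneChart_symm h1).comp p contDiff_fst.contMDiff.contMDiffAt
  have e2 : ContMDiffAt 𝓘(ℝ, V × V) 𝓘(ℝ, V) ∞ (fun p : V × V => (oneChart V G).symm p.2) p :=
    (contMDiffAt_oneChart_symm h2).comp p contDiff_snd.contMDiff.contMDiffAt
  exact (contMDiffAt_oneChart h3).comp p (e1.mul e2)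

theorem contDiffAt_chartConj {p : V × V} (h1 : p.1 ∈ (oneChart V G).target)
    (h2 : p.2 ∈ (oneChart V G).target)
    (h3 : (oneChart V G).symm p.1 * (oneChart V G).symm p.2 * ((oneChart V G).symm p.1)⁻¹
      ∈ (oneChart V G).source) :
    ContDiffAt ℝ ∞ (chartConj V G) p := by
  rw [← contMDiffAt_iff_contDiffAt]
  have e1 : ContMDiffAt 𝓘(ℝ, V × V) 𝓘(ℝ, V) ∞ (fun p : V × V => (oneChart V G).symm p.1) p :=
    (contMDiffAt_oneChart_symm h1).comp p contDiff_fst.contMDiff.contMDiffAt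
  have e2 : ContMDiffAt 𝓘(ℝ, V × V) 𝓘(ℝ, V) ∞ (fun p : V × V => (oneChart V G).symm p.2) p :=
    (contMDiffAt_oneChart_symm h2).comp p contDiff_snd.contMDiff.contMDiffAt
  exact (contMDiffAt_oneChart h3).comp p ((e1.mul e2).mul e1.inv)

theorem hasMFDerivAt_oneChart_one :
    HasMFDerivAt 𝓘(ℝ, V) 𝓘(ℝ, V) (oneChart V G) 1 (ContinuousLinearMap.id ℝ V) := by
  have h := ((contMDiffAt_oneChart (V := V) (one_mem_source (G := G))).mdifferentiableAt
    (by simp)).hasMFDerivAt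
  exact h.congr_mfderiv mfderiv_extChartAt_self

theorem hasMFDerivAt_oneChart_symm :
    HasMFDerivAt 𝓘(ℝ, V) 𝓘(ℝ, V) (oneChart V G).symm (oneChart V G 1)
      (ContinuousLinearMap.id ℝ V) := by
  have h := ((contMDiffAt_oneChart_symm (V := V) (oneChart_one_mem_target (G := G))).mdifferentiableAt
    (by simp)).hasMFDerivAt
  refine h.congr_mfderiv ?_
  rw [← mfderivWithin_univ]
  have := mfderivWithin_range_extChartAt_symm (I := 𝓘(ℝ, V)) (x := (1 : G))
  simpa only [modelWithCornersSelf_coe, range_id] using! this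

theorem hasMFDerivAt_comp_of_eq {F₁ F₂ F₃ : Type*} [NormedAddCommGroup F₁] [NormedSpace ℝ F₁]
    [NormedAddCommGroup F₂] [NormedSpace ℝ F₂] [NormedAddCommGroup F₃] [NormedSpace ℝ F₃]
    {M₁ M₂ M₃ : Type*} [TopologicalSpace M₁] [ChartedSpace F₁ M₁] [TopologicalSpace M₂]
    [ChartedSpace F₂ M₂] [TopologicalSpace M₃] [ChartedSpace F₃ M₃]
    {g : M₂ → M₃} {f : M₁ → M₂} {x : M₁} {y : M₂} {g' : F₂ →L[ℝ] F₃} {f' : F₁ →L[ℝ] F₂}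
    (hg : HasMFDerivAt 𝓘(ℝ, F₂) 𝓘(ℝ, F₃) g y g') (hf : HasMFDerivAt 𝓘(ℝ, F₁) 𝓘(ℝ, F₂) f x f')
    (h : f x = y) :
    HasMFDerivAt 𝓘(ℝ, F₁) 𝓘(ℝ, F₃) (fun z => g (f z)) x (g'.comp f') := by
  subst h
  exact hg.comp x hf

/-- In the chart at the identity, the left-invariant vector field with value `ξ` at the identity is
the partial derivative of the multiplication in its second argument. -/
theorem fderiv_chartMul_eq {g : G} (hg : g ∈ (oneChart V G).source) (ξ : V) :
    fderiv ℝ (chartMul V G) (oneChart V G g, oneChart V G 1) (0, ξ)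
      = (mfderiv 𝓘(ℝ, V) 𝓘(ℝ, V) (oneChart V G) g : V →L[ℝ] V)
          (mulInvariantVectorField (I := 𝓘(ℝ, V)) ξ g) := by
  have hgt : oneChart V G g ∈ (oneChart V G).target := (oneChart V G).map_source hg
  have hd : DifferentiableAt ℝ (chartMul V G) (oneChart V G g, oneChart V G 1) :=
    (contDiffAt_chartMul hgt oneChart_one_mem_target (by
      simpa only [oneChart_symm_one, mul_one, (oneChart V G).left_inv hg] using hg)).differentiableAt
      (by simp)
  have h1 : HasFDerivAt (fun y : V => chartMul V G (oneChart V G g, y))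
      ((fderiv ℝ (chartMul V G) (oneChart V G g, oneChart V G 1)).comp
        (ContinuousLinearMap.inr ℝ V V)) (oneChart V G 1) :=
    hd.hasFDerivAt.comp (oneChart V G 1) (hasFDerivAt_prodMk_right _ _)
  have hL : HasMFDerivAt 𝓘(ℝ, V) 𝓘(ℝ, V) (fun b : G => g * b) 1
      (mfderiv 𝓘(ℝ, V) 𝓘(ℝ, V) (fun b : G => g * b) 1) :=
    ((contMDiff_mul_left (I := 𝓘(ℝ, V)) (n := ∞) (a := g)).mdifferentiableAt
      (by simp)).hasMFDerivAt
  have hφ : HasMFDerivAt 𝓘(ℝ, V) 𝓘(ℝ, V) (oneChart V G) (g * 1)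
      (mfderiv 𝓘(ℝ, V) 𝓘(ℝ, V) (oneChart V G) g : V →L[ℝ] V) := by
    rw [mul_one]
    exact ((contMDiffAt_oneChart hg).mdifferentiableAt (by simp)).hasMFDerivAt
  have h2 := hasMFDerivAt_iff_hasFDerivAt.1 (hasMFDerivAt_comp_of_eq hφ
    (hasMFDerivAt_comp_of_eq hL hasMFDerivAt_oneChart_symm oneChart_symm_one) (by simp))
  have h3 : (fun y : V => oneChart V G (g * (oneChart V G).symm y))
      = fun y : V => chartMul V G (oneChart V G g, y) := by
    funext y
    simp only [chartMul, (oneChart V G).left_inv hg]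
  rw [h3] at h2
  have h4 := DFunLike.congr_fun (h1.unique h2) ξ
  exact h4

/-- In the chart at the identity, the adjoint action is the partial derivative of the conjugation
in its second argument. -/
theorem fderiv_chartConj_eq {g : G} (hg : g ∈ (oneChart V G).source) (η : V) :
    fderiv ℝ (chartConj V G) (oneChart V G g, oneChart V G 1) (0, η) = Ad V g η := by
  have hgt : oneChart V G g ∈ (oneChart V G).target := (oneChart V G).map_source hg
  have hd : DifferentiableAt ℝ (chartConj V G) (oneChart V G g, oneChart V G 1) :=
    (contDiffAt_chartConj hgt oneChart_one_mem_target (by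
      simpa only [oneChart_symm_one, mul_one, mul_inv_cancel] using one_mem_source)).differentiableAt
      (by simp)
  have h1 : HasFDerivAt (fun y : V => chartConj V G (oneChart V G g, y))
      ((fderiv ℝ (chartConj V G) (oneChart V G g, oneChart V G 1)).comp
        (ContinuousLinearMap.inr ℝ V V)) (oneChart V G 1) :=
    hd.hasFDerivAt.comp (oneChart V G 1) (hasFDerivAt_prodMk_right _ _)
  have hφ : HasMFDerivAt 𝓘(ℝ, V) 𝓘(ℝ, V) (oneChart V G) (g * 1 * g⁻¹)
      (ContinuousLinearMap.id ℝ V) := by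
    rw [mul_one, mul_inv_cancel]
    exact hasMFDerivAt_oneChart_one
  have h2 := hasMFDerivAt_iff_hasFDerivAt.1 (hasMFDerivAt_comp_of_eq hφ
    (hasMFDerivAt_comp_of_eq (Ad_hasMFDerivAt V g) hasMFDerivAt_oneChart_symm oneChart_symm_one)
    (by simp))
  have h3 : (fun y : V => oneChart V G (g * (oneChart V G).symm y * g⁻¹))
      = fun y : V => chartConj V G (oneChart V G g, y) := by
    funext y
    simp only [chartConj, (oneChart V G).left_inv hg]
  rw [h3] at h2
  exact DFunLike.congr_fun (h1.unique h2) η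

/-- The Lie bracket as the antisymmetrised mixed second derivative of the multiplication. -/
theorem lieBr_eq_fderiv_sub (ξ η : V) :
    lieBr G ξ η
      = fderiv ℝ (fun x => fderiv ℝ (chartMul V G) (x, oneChart V G 1) (0, η)) (oneChart V G 1) ξ
        - fderiv ℝ (fun x => fderiv ℝ (chartMul V G) (x, oneChart V G 1) (0, ξ))
            (oneChart V G 1) η := by
  obtain ⟨X, hX⟩ : ∃ X : V → V → V, ∀ ζ, X ζ = mpullbackWithin 𝓘(ℝ, V) 𝓘(ℝ, V)
      (oneChart V G).symm (mulInvariantVectorField (I := 𝓘(ℝ, V)) (G := G) ζ) univ :=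
    ⟨fun ζ => mpullbackWithin 𝓘(ℝ, V) 𝓘(ℝ, V) (oneChart V G).symm
      (mulInvariantVectorField (I := 𝓘(ℝ, V)) (G := G) ζ) univ, fun _ => rfl⟩
  have key : ∀ ζ : V, X ζ =ᶠ[𝓝 (oneChart V G 1)]
      fun x => fderiv ℝ (chartMul V G) (x, oneChart V G 1) (0, ζ) := by
    intro ζ
    rw [hX]
    filter_upwards [(isOpen_extChartAt_target (I := 𝓘(ℝ, V)) (1 : G)).mem_nhds
      oneChart_one_mem_target] with x hx
    have hg : (oneChart V G).symm x ∈ (oneChart V G).source := (oneChart V G).map_target hx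
    have h1 := fderiv_chartMul_eq hg ζ
    rw [(oneChart V G).right_inv hx] at h1
    refine Eq.trans ?_ h1.symm
    have hinv := mfderivWithin_extChartAt_symm_comp_mfderiv_extChartAt (I := 𝓘(ℝ, V)) hx
    have hinv' := mfderiv_extChartAt_comp_mfderivWithin_extChartAt_symm (I := 𝓘(ℝ, V)) hx
    rw [modelWithCornersSelf_coe, range_id] at hinv hinv'
    have h2 := ContinuousLinearMap.inverse_eq hinv hinv'
    exact DFunLike.congr_fun h2 _
  have hx : ∀ ζ : V, fderiv ℝ (chartMul V G) (oneChart V G 1, oneChart V G 1) (0, ζ) = ζ := by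
    intro ζ
    rw [fderiv_chartMul_eq one_mem_source]
    have h1 : mulInvariantVectorField (I := 𝓘(ℝ, V)) (G := G) ζ 1 = ζ := by
      have e : (fun b : G => (1 : G) * b) = id := by ext b; simp
      unfold mulInvariantVectorField
      rw [e, mfderiv_id]
      rfl
    rw [h1]
    exact DFunLike.congr_fun (mfderiv_extChartAt_self (I := 𝓘(ℝ, V)) (x := (1 : G))) ζ
  have h := GroupLieAlgebra.bracket_def (I := 𝓘(ℝ, V)) (G := G) ξ η
  have h0 : lieBr G ξ η = lieBracketWithin ℝ (X ξ) (X η) univ (oneChart V G 1) := by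
    refine h.trans ?_
    rw [← mlieBracketWithin_univ, mlieBracketWithin_apply, mfderiv_extChartAt_self,
      modelWithCornersSelf_coe, range_id, preimage_univ, inter_univ, hX, hX]
    exact DFunLike.congr_fun (ContinuousLinearMap.inverse_id (R := ℝ) (M := V)) _
  rw [h0, lieBracketWithin_univ, lieBracket_eq]
  simp only [(key ξ).fderiv_eq, (key η).fderiv_eq, (key ξ).self_of_nhds, (key η).self_of_nhds, hx]

end ChartAtOne

/-! ### The derivative of the adjoint action -/

section AdDerivative

set_option linter.unusedSectionVars false

open Set

variable {V : Type*} [NormedAddCommGroup V] [NormedSpace ℝ V] [FiniteDimensional ℝ V]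
  {G : Type*} [TopologicalSpace G] [ChartedSpace V G] [Group G] [LieGroup 𝓘(ℝ, V) ∞ G]

theorem target_mem_nhds : (oneChart V G).target ∈ 𝓝 (oneChart V G 1) :=
  (isOpen_extChartAt_target _).mem_nhds oneChart_one_mem_target

theorem contDiffAt_chartMul_one : ContDiffAt ℝ ∞ (chartMul V G) (oneChart V G 1, oneChart V G 1) :=
  contDiffAt_chartMul oneChart_one_mem_target oneChart_one_mem_target
    (by simpa only [oneChart_symm_one, mul_one] using one_mem_source)

/-- The chart form of `(a b a⁻¹) a = a b`, differentiated in `b` at the identity. -/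
theorem fderiv_chartMul_Ad {x : V} (hx : x ∈ (oneChart V G).target) (η : V) :
    fderiv ℝ (chartMul V G) (oneChart V G 1, x) (Ad V ((oneChart V G).symm x) η, 0)
      = fderiv ℝ (chartMul V G) (x, oneChart V G 1) (0, η) := by
  set g : G := (oneChart V G).symm x with hg
  have hgs : g ∈ (oneChart V G).source := (oneChart V G).map_target hx
  have hgx : oneChart V G g = x := (oneChart V G).right_inv hx
  have hc1 : chartConj V G (x, oneChart V G 1) = oneChart V G 1 := by
    simp only [chartConj, oneChart_symm_one, mul_one, mul_inv_cancel]
  have hc : HasFDerivAt (fun y => chartConj V G (x, y))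
      ((fderiv ℝ (chartConj V G) (x, oneChart V G 1)).comp (ContinuousLinearMap.inr ℝ V V))
      (oneChart V G 1) :=
    ((contDiffAt_chartConj (p := (x, oneChart V G 1)) hx oneChart_one_mem_target (by
      simpa only [oneChart_symm_one, mul_one, mul_inv_cancel] using
        one_mem_source)).differentiableAt (by simp)).hasFDerivAt.comp _
      (hasFDerivAt_prodMk_right _ _)
  have hm1 : HasFDerivAt (chartMul V G) (fderiv ℝ (chartMul V G) (oneChart V G 1, x))
      (chartConj V G (x, oneChart V G 1), x) := by
    rw [hc1]
    exact ((contDiffAt_chartMul (p := (oneChart V G 1, x)) oneChart_one_mem_target hx (by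
      simpa only [oneChart_symm_one, one_mul] using hgs)).differentiableAt (by simp)).hasFDerivAt
  have hm2 : HasFDerivAt (fun y => chartMul V G (x, y))
      ((fderiv ℝ (chartMul V G) (x, oneChart V G 1)).comp (ContinuousLinearMap.inr ℝ V V))
      (oneChart V G 1) :=
    ((contDiffAt_chartMul (p := (x, oneChart V G 1)) hx oneChart_one_mem_target (by
      simpa only [oneChart_symm_one, mul_one] using hgs)).differentiableAt (by simp)).hasFDerivAt.comp _
      (hasFDerivAt_prodMk_right _ _)
  have hm3 := hm1.comp (oneChart V G 1) (hc.prodMk (hasFDerivAt_const x (oneChart V G 1)))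
  have hcont : ContinuousAt (fun y : V => g * (oneChart V G).symm y * g⁻¹) (oneChart V G 1) := by
    have : IsTopologicalGroup G := topologicalGroup_of_lieGroup 𝓘(ℝ, V) ∞
    have h := (contMDiffAt_oneChart_symm (V := V) (oneChart_one_mem_target (G := G))).continuousAt
    exact (continuousAt_const.mul h).mul continuousAt_const
  have hev : (chartMul V G ∘ fun y => (chartConj V G (x, y), x)) =ᶠ[𝓝 (oneChart V G 1)]
      fun y => chartMul V G (x, y) := by
    have hn : (oneChart V G).source ∈ 𝓝 (g * (oneChart V G).symm (oneChart V G 1) * g⁻¹) := by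
      rw [oneChart_symm_one, mul_one, mul_inv_cancel]
      exact extChartAt_source_mem_nhds _
    filter_upwards [hcont.preimage_mem_nhds hn] with y hy
    simp only [Function.comp_apply, chartMul, chartConj, ← hg]
    rw [(oneChart V G).left_inv hy]
    group
  have h := DFunLike.congr_fun (hm3.unique (hm2.congr_of_eventuallyEq hev)) η
  have h2 := fderiv_chartConj_eq hgs η
  rw [hgx] at h2
  rw [← h2]
  exact h

theorem fderiv_chartMul_left (v : V) :
    fderiv ℝ (chartMul V G) (oneChart V G 1, oneChart V G 1) (v, 0) = v := by
  have h1 : HasFDerivAt (fun y => chartMul V G (y, oneChart V G 1))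
      ((fderiv ℝ (chartMul V G) (oneChart V G 1, oneChart V G 1)).comp
        (ContinuousLinearMap.inl ℝ V V)) (oneChart V G 1) :=
    HasFDerivAt.comp (f := fun y : V => (y, oneChart V G 1)) (oneChart V G 1)
      (contDiffAt_chartMul_one.differentiableAt (by simp)).hasFDerivAt
      (hasFDerivAt_prodMk_left _ _)
  have h2 : (fun y => chartMul V G (y, oneChart V G 1)) =ᶠ[𝓝 (oneChart V G 1)] id := by
    filter_upwards [target_mem_nhds] with y hy
    simp only [chartMul, oneChart_symm_one, mul_one, (oneChart V G).right_inv hy, id]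
  exact DFunLike.congr_fun (h1.unique ((hasFDerivAt_id _).congr_of_eventuallyEq h2)) v

/-- The derivative of the adjoint action at the identity is the Lie bracket. -/
theorem hasFDerivAt_Ad_oneChart_symm (η : V) :
    ∃ A : V →L[ℝ] V, HasFDerivAt (fun x => Ad V ((oneChart V G).symm x) η) A (oneChart V G 1) ∧
      ∀ ξ, A ξ = lieBr G ξ η := by
  set e : V := oneChart V G 1 with he
  have hd : DifferentiableAt ℝ (fun x => Ad V ((oneChart V G).symm x) η) e := by
    have h1 : ContDiffAt ℝ ∞ (chartConj V G) (e, e) :=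
      contDiffAt_chartConj oneChart_one_mem_target oneChart_one_mem_target
        (by simpa only [he, oneChart_symm_one, mul_one, inv_one] using one_mem_source)
    have h2 : DifferentiableAt ℝ (fderiv ℝ (chartConj V G)) (e, e) :=
      (h1.fderiv_right (m := 1) (by norm_cast)).differentiableAt (by simp)
    have h3 : DifferentiableAt ℝ (fun x => fderiv ℝ (chartConj V G) (x, e) (0, η)) e :=
      (DifferentiableAt.comp (f := fun y : V => (y, e)) e h2 (differentiableAt_id.prodMk (differentiableAt_const _))).clm_apply
        (differentiableAt_const _)
    refine h3.congr_of_eventuallyEq ?_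
    filter_upwards [target_mem_nhds] with x hx
    have := fderiv_chartConj_eq ((oneChart V G).map_target hx) η
    rw [(oneChart V G).right_inv hx] at this
    exact this.symm
  refine ⟨_, hd.hasFDerivAt, fun ξ => ?_⟩
  have hD : DifferentiableAt ℝ (fderiv ℝ (chartMul V G)) (e, e) :=
    (contDiffAt_chartMul_one.fderiv_right (m := 1) (by norm_cast)).differentiableAt (by simp)
  set B := fderiv ℝ (fderiv ℝ (chartMul V G)) (e, e) with hB
  have hr : ∀ ζ : V, HasFDerivAt (fun x => fderiv ℝ (chartMul V G) (x, e) (0, ζ))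
      (((B.comp (ContinuousLinearMap.inl ℝ V V)).flip (0, ζ))) e := by
    intro ζ
    have h1 : HasFDerivAt (fun x => fderiv ℝ (chartMul V G) (x, e))
      (B.comp (ContinuousLinearMap.inl ℝ V V)) e :=
      HasFDerivAt.comp (f := fun y : V => (y, e)) e hD.hasFDerivAt (hasFDerivAt_prodMk_left e e)
    simpa using h1.clm_apply (hasFDerivAt_const ((0, ζ) : V × V) e)
  have h1 : HasFDerivAt (fun x => fderiv ℝ (chartMul V G) (e, x))
      (B.comp (ContinuousLinearMap.inr ℝ V V)) e :=
      hD.hasFDerivAt.comp e (hasFDerivAt_prodMk_right e e)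
  have h2 := h1.clm_apply (hd.hasFDerivAt.prodMk (hasFDerivAt_const (0 : V) e))
  have h3 : (fun x => fderiv ℝ (chartMul V G) (e, x) (Ad V ((oneChart V G).symm x) η, 0))
      =ᶠ[𝓝 e] fun x => fderiv ℝ (chartMul V G) (x, e) (0, η) := by
    filter_upwards [target_mem_nhds] with x hx using fderiv_chartMul_Ad hx η
  have h4 := DFunLike.congr_fun (h2.unique ((hr η).congr_of_eventuallyEq h3)) ξ
  have hsymm : B (0, ξ) (η, 0) = B (η, 0) (0, ξ) :=
    (contDiffAt_chartMul_one.isSymmSndFDerivAt (by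
      rw [minSmoothness_of_isRCLikeNormedField]; exact ENat.LEInfty.out)) (0, ξ) (η, 0)
  rw [lieBr_eq_fderiv_sub, (hr η).fderiv, (hr ξ).fderiv]
  simp only [add_apply, ContinuousLinearMap.comp_apply,
    ContinuousLinearMap.flip_apply, ContinuousLinearMap.prod_apply,
    ContinuousLinearMap.inr_apply, ContinuousLinearMap.inl_apply, he, oneChart_symm_one,
    Ad_one_apply, zero_apply] at h4 ⊢
  rw [fderiv_chartMul_left] at h4
  rw [← h4, ← he, hsymm]
  abel

theorem hasDerivAt_Ad_curve {γ : ℝ → G} {ξ : V} (h0 : γ 0 = 1)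
    (hγ : HasMFDerivAt 𝓘(ℝ, ℝ) 𝓘(ℝ, V) γ 0 (ContinuousLinearMap.toSpanSingleton ℝ ξ)) (η : V) :
    HasDerivAt (fun s => Ad V (γ s) η) (lieBr G ξ η) 0 := by
  obtain ⟨A, hA, hA'⟩ := hasFDerivAt_Ad_oneChart_symm (G := G) η
  have h1 := hasMFDerivAt_iff_hasFDerivAt.1
    (hasMFDerivAt_comp_of_eq hasMFDerivAt_oneChart_one hγ h0)
  have hA0 : HasFDerivAt (fun x => Ad V ((oneChart V G).symm x) η) A (oneChart V G (γ 0)) := by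
    rw [h0]; exact hA
  have h2 := (hA0.comp (0 : ℝ) h1).hasDerivAt
  have h3 : (fun s => Ad V (γ s) η)
      =ᶠ[𝓝 0] (fun x => Ad V ((oneChart V G).symm x) η) ∘ fun s => oneChart V G (γ s) := by
    have hn : (oneChart V G).source ∈ 𝓝 (γ 0) := by rw [h0]; exact extChartAt_source_mem_nhds _
    filter_upwards [hγ.continuousAt.preimage_mem_nhds hn] with s hs
    simp only [Function.comp_apply, (oneChart V G).left_inv hs]
  refine (h2.congr_of_eventuallyEq h3).congr_deriv ?_
  change A ((1 : ℝ) • ξ) = _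
  rw [one_smul, hA']

end AdDerivative

/-! ### One-parameter subgroups and the exponential map -/

section OneParam

set_option linter.unusedSectionVars false

open Set

variable {V : Type*} [NormedAddCommGroup V] [NormedSpace ℝ V] [FiniteDimensional ℝ V]
  {G : Type*} [TopologicalSpace G] [ChartedSpace V G] [Group G] [LieGroup 𝓘(ℝ, V) ∞ G]

theorem mfderiv_mul_left_mulInvariantVectorField (ξ : V) (g h : G) :
    (mfderiv 𝓘(ℝ, V) 𝓘(ℝ, V) (fun b : G => g * b) h : V →L[ℝ] V)
        (mulInvariantVectorField (I := 𝓘(ℝ, V)) ξ h)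
      = mulInvariantVectorField (I := 𝓘(ℝ, V)) ξ (g * h) := by
  have hm : ∀ a b : G, HasMFDerivAt 𝓘(ℝ, V) 𝓘(ℝ, V) (fun b : G => a * b) b
      (mfderiv 𝓘(ℝ, V) 𝓘(ℝ, V) (fun b : G => a * b) b) := fun a b =>
    ((contMDiff_mul_left (I := 𝓘(ℝ, V)) (n := ∞) (a := a)).mdifferentiableAt
      (by simp)).hasMFDerivAt
  have h1 := hasMFDerivAt_comp_of_eq (hm g h) (hm h 1) (mul_one h)
  have h2 : (fun z : G => g * (h * z)) = fun z => g * h * z := by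
    funext z; rw [mul_assoc]
  rw [h2] at h1
  exact DFunLike.congr_fun (hasMFDerivAt_unique h1 (hm (g * h) 1)) ξ

theorem mulInvariantVectorField_one (ξ : V) :
    mulInvariantVectorField (I := 𝓘(ℝ, V)) (G := G) ξ 1 = ξ := by
  have e : (fun b : G => (1 : G) * b) = id := by ext b; simp
  unfold mulInvariantVectorField
  rw [e, mfderiv_id]
  rfl

theorem contMDiff_one_mulInvariantVectorField (ξ : V) :
    ContMDiff 𝓘(ℝ, V) (𝓘(ℝ, V)).tangent 1
      (fun g : G => (⟨g, mulInvariantVectorField (I := 𝓘(ℝ, V)) ξ g⟩ : TangentBundle 𝓘(ℝ, V) G)) :=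
  (contMDiff_mulInvariantVectorField (I := 𝓘(ℝ, V)) (G := G) ξ).of_le (by
    rw [minSmoothness_of_isRCLikeNormedField]; norm_num)

theorem isMIntegralCurve_mul_left {γ : ℝ → G} {ξ : V} {s : Set ℝ} (a : G)
    (hγ : IsMIntegralCurveOn γ (mulInvariantVectorField (I := 𝓘(ℝ, V)) ξ) s) :
    IsMIntegralCurveOn (fun t => a * γ t) (mulInvariantVectorField (I := 𝓘(ℝ, V)) ξ) s := by
  intro t ht
  have hm : HasMFDerivAt 𝓘(ℝ, V) 𝓘(ℝ, V) (fun b : G => a * b) (γ t)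
      (mfderiv 𝓘(ℝ, V) 𝓘(ℝ, V) (fun b : G => a * b) (γ t)) :=
    ((contMDiff_mul_left (I := 𝓘(ℝ, V)) (n := ∞) (a := a)).mdifferentiableAt
      (by simp)).hasMFDerivAt
  have h := hm.comp_hasMFDerivWithinAt t (hγ t ht)
  refine h.congr_mfderiv ?_
  ext
  have := mfderiv_mul_left_mulInvariantVectorField ξ a (γ t)
  change _ = (1 : ℝ) • (mulInvariantVectorField (I := 𝓘(ℝ, V)) ξ (a * γ t) : V)
  rw [← this]
  change (mfderiv 𝓘(ℝ, V) 𝓘(ℝ, V) (fun b : G => a * b) (γ t) : V →L[ℝ] V)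
    ((1 : ℝ) • (mulInvariantVectorField (I := 𝓘(ℝ, V)) ξ (γ t) : V)) = _
  exact map_smul _ _ _

namespace IsOneParamSubgroup

variable {γ γ' : ℝ → G} {ξ η : V}

theorem map_zero (h : IsOneParamSubgroup 𝓘(ℝ, V) γ ξ) : γ 0 = 1 := by
  have := h.map_add 0 0
  rw [add_zero] at this
  exact left_eq_mul.1 this

theorem hasMFDerivAt_zero (h : IsOneParamSubgroup 𝓘(ℝ, V) γ ξ) :
    HasMFDerivAt 𝓘(ℝ, ℝ) 𝓘(ℝ, V) γ 0 (ContinuousLinearMap.toSpanSingleton ℝ ξ) := by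
  refine (h.smooth.mdifferentiableAt (x := 0) (by simp)).hasMFDerivAt.congr_mfderiv ?_
  ext
  exact h.velocity.trans (one_smul ℝ ξ).symm

theorem of_hasMFDerivAt (h1 : ∀ s t, γ (s + t) = γ s * γ t)
    (h2 : ContMDiff 𝓘(ℝ, ℝ) 𝓘(ℝ, V) ∞ γ)
    (h3 : HasMFDerivAt 𝓘(ℝ, ℝ) 𝓘(ℝ, V) γ 0 (ContinuousLinearMap.toSpanSingleton ℝ ξ)) :
    IsOneParamSubgroup 𝓘(ℝ, V) γ ξ where
  map_add := h1
  smooth := h2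
  velocity := by
    rw [h3.mfderiv]
    exact one_smul ℝ ξ

theorem isMIntegralCurve (h : IsOneParamSubgroup 𝓘(ℝ, V) γ ξ) :
    IsMIntegralCurve γ (mulInvariantVectorField (I := 𝓘(ℝ, V)) ξ) := by
  intro t
  have hm : HasMFDerivAt 𝓘(ℝ, V) 𝓘(ℝ, V) (fun b : G => γ t * b) 1
      (mfderiv 𝓘(ℝ, V) 𝓘(ℝ, V) (fun b : G => γ t * b) 1) :=
    ((contMDiff_mul_left (I := 𝓘(ℝ, V)) (n := ∞) (a := γ t)).mdifferentiableAt
      (by simp)).hasMFDerivAt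
  have hs : HasMFDerivAt 𝓘(ℝ, ℝ) 𝓘(ℝ, ℝ) (fun s : ℝ => s - t) t (ContinuousLinearMap.id ℝ ℝ) :=
    ((hasFDerivAt_id t).sub_const t).hasMFDerivAt
  have h1 := hasMFDerivAt_comp_of_eq hm
    (hasMFDerivAt_comp_of_eq h.hasMFDerivAt_zero hs (sub_self t)) (by simp [h.map_zero])
  have h2 : (fun s => γ t * γ (s - t)) = γ := by
    funext s
    rw [← h.map_add, add_sub_cancel]
  rw [h2] at h1
  refine h1.congr_mfderiv ?_
  ext
  change _ = (1 : ℝ) • (mulInvariantVectorField (I := 𝓘(ℝ, V)) ξ (γ t) : V)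
  exact map_smul (mfderiv 𝓘(ℝ, V) 𝓘(ℝ, V) (fun b : G => γ t * b) 1 : V →L[ℝ] V) (1 : ℝ) ξ

theorem eq [T2Space G] (h : IsOneParamSubgroup 𝓘(ℝ, V) γ ξ)
    (h' : IsOneParamSubgroup 𝓘(ℝ, V) γ' ξ) : γ = γ' :=
  isMIntegralCurve_Ioo_eq_of_contMDiff_boundaryless (t₀ := 0)
    (contMDiff_one_mulInvariantVectorField ξ) h.isMIntegralCurve h'.isMIntegralCurve
    (h.map_zero.trans h'.map_zero.symm)

end IsOneParamSubgroup

/-- An integral curve of a left-invariant vector field through the identity is smooth near `0`,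
being a solution of an ordinary differential equation with smooth coefficients. -/
theorem contMDiffAt_zero_of_isMIntegralCurve {γ : ℝ → G} {ξ : V} (h0 : γ 0 = 1)
    (hγ : IsMIntegralCurve γ (mulInvariantVectorField (I := 𝓘(ℝ, V)) ξ)) :
    ContMDiffAt 𝓘(ℝ, ℝ) 𝓘(ℝ, V) ∞ γ 0 := by
  set f : V → V := fun x => fderiv ℝ (chartMul V G) (x, oneChart V G 1) (0, ξ) with hf
  have hfs : ContDiffOn ℝ ∞ f (oneChart V G).target := by
    intro x hx
    have h1 : ContDiffAt ℝ ∞ (chartMul V G) (x, oneChart V G 1) :=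
      contDiffAt_chartMul hx oneChart_one_mem_target
        (by simpa only [oneChart_symm_one, mul_one] using (oneChart V G).map_target hx)
    have h2 : ContDiffAt ℝ ∞ (fderiv ℝ (chartMul V G)) (x, oneChart V G 1) :=
      h1.fderiv_right (by norm_cast)
    have h3 : ContDiffAt ℝ ∞ (fun y : V => fderiv ℝ (chartMul V G) (y, oneChart V G 1)) x :=
      ContDiffAt.comp (f := fun y : V => (y, oneChart V G 1)) x h2
        (contDiffAt_id.prodMk contDiffAt_const)
    exact (h3.clm_apply contDiffAt_const).contDiffWithinAt
  have hsrc : ∀ᶠ t in 𝓝 (0 : ℝ), γ t ∈ (oneChart V G).source := by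
    have hn : (oneChart V G).source ∈ 𝓝 (γ 0) := by rw [h0]; exact extChartAt_source_mem_nhds _
    exact (hγ 0).continuousAt.preimage_mem_nhds hn
  obtain ⟨ε, hε, hball⟩ := Metric.eventually_nhds_iff_ball.1 hsrc
  have hsub : Icc (-(ε / 2)) (ε / 2) ⊆ Metric.ball (0 : ℝ) ε := by
    intro t ht
    rw [Metric.mem_ball, dist_zero_right, Real.norm_eq_abs, abs_lt]
    constructor <;> linarith [ht.1, ht.2]
  have hder : ∀ t ∈ Icc (-(ε / 2)) (ε / 2),
      HasDerivAt (fun t => oneChart V G (γ t)) (f (oneChart V G (γ t))) t := by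
    intro t ht
    have hs := hball t (hsub ht)
    obtain ⟨L, hL⟩ : ∃ L : V →L[ℝ] V,
      L = mfderiv 𝓘(ℝ, V) 𝓘(ℝ, V) (oneChart V G) (γ t) := ⟨_, rfl⟩
    obtain ⟨w, hw⟩ : ∃ w : V, w = mulInvariantVectorField (I := 𝓘(ℝ, V)) ξ (γ t) := ⟨_, rfl⟩
    have hφ : HasMFDerivAt 𝓘(ℝ, V) 𝓘(ℝ, V) (oneChart V G) (γ t) L := by
      rw [hL]
      exact ((contMDiffAt_oneChart hs).mdifferentiableAt (by simp)).hasMFDerivAt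
    have hγt : HasMFDerivAt 𝓘(ℝ, ℝ) 𝓘(ℝ, V) γ t (ContinuousLinearMap.toSpanSingleton ℝ w) := by
      refine (hγ t).congr_mfderiv ?_
      ext
      exact congrArg ((1 : ℝ) • ·) hw.symm
    have h1 : HasFDerivAt (fun t => oneChart V G (γ t))
        (L.comp (ContinuousLinearMap.toSpanSingleton ℝ w)) t :=
      hasMFDerivAt_iff_hasFDerivAt.1 (hasMFDerivAt_comp_of_eq hφ hγt rfl)
    have h2 : f (oneChart V G (γ t)) = L w := by
      rw [hL, hw]
      exact fderiv_chartMul_eq hs ξ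
    refine h1.hasDerivAt.congr_deriv ?_
    rw [h2]
    simp
  have hα : ContDiffOn ℝ ∞ (fun t => oneChart V G (γ t)) (Icc (-(ε / 2)) (ε / 2)) :=
    ODE.contDiffOn_enat_Icc_of_hasDerivWithinAt (f := fun _ => f) (n := ⊤)
      (u := (oneChart V G).target)
      (hfs.comp contDiff_snd.contDiffOn fun p hp => hp.2)
      (fun t ht => (hder t ht).hasDerivWithinAt)
      (fun t ht => (oneChart V G).map_source (hball t (hsub ht)))
  have hα0 : ContDiffAt ℝ ∞ (fun t => oneChart V G (γ t)) 0 :=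
    hα.contDiffAt (Icc_mem_nhds (by linarith) (by linarith))
  have hs0 : ContMDiffAt 𝓘(ℝ, V) 𝓘(ℝ, V) ∞ (oneChart V G).symm (oneChart V G (γ 0)) := by
    rw [h0]; exact contMDiffAt_oneChart_symm oneChart_one_mem_target
  refine (hs0.comp (0 : ℝ) hα0.contMDiffAt).congr_of_eventuallyEq ?_
  filter_upwards [hsrc] with t ht
  exact ((oneChart V G).left_inv ht).symm

/-- Every element of the Lie algebra is the velocity of a one-parameter subgroup: a local integral
curve of the left-invariant vector field can be translated to any point of the group, and hence be
continued for all times. -/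
theorem exists_isOneParamSubgroup [T2Space G] (ξ : V) :
    ∃ γ : ℝ → G, IsOneParamSubgroup 𝓘(ℝ, V) γ ξ := by
  have hv := contMDiff_one_mulInvariantVectorField (G := G) ξ
  obtain ⟨γ₀, h₀, hγ₀⟩ :=
    exists_isMIntegralCurveAt_of_contMDiffAt_boundaryless (t₀ := 0) (hv.contMDiffAt (x := 1))
  obtain ⟨ε, hε, hγ₀⟩ := isMIntegralCurveAt_iff'.1 hγ₀
  rw [Real.ball_eq_Ioo, zero_sub, zero_add] at hγ₀
  obtain ⟨γ, h0, hγ⟩ := exists_isMIntegralCurve_of_isMIntegralCurveOn hv hε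
    (fun x => ⟨fun t => x * γ₀ t, by simp [h₀], isMIntegralCurve_mul_left x hγ₀⟩) 1
  have hadd : ∀ s t, γ (s + t) = γ s * γ t := by
    intro s t
    have h1 := hγ.comp_add s
    have h2 : IsMIntegralCurve (fun t => γ s * γ t) (mulInvariantVectorField (I := 𝓘(ℝ, V)) ξ) := by
      rw [isMIntegralCurve_iff_isMIntegralCurveOn] at hγ ⊢
      exact isMIntegralCurve_mul_left (γ s) hγ
    have h3 := isMIntegralCurve_Ioo_eq_of_contMDiff_boundaryless (t₀ := 0) hv h1 h2
      (by simp [h0])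
    simpa [add_comm] using congrFun h3 t
  refine ⟨γ, IsOneParamSubgroup.of_hasMFDerivAt hadd (fun s => ?_) ?_⟩
  · have h1 : ContMDiffAt 𝓘(ℝ, ℝ) 𝓘(ℝ, V) ∞ γ (s - s) := by
      rw [sub_self]; exact contMDiffAt_zero_of_isMIntegralCurve h0 hγ
    have h2 : ContMDiffAt 𝓘(ℝ, ℝ) 𝓘(ℝ, ℝ) ∞ (fun t : ℝ => t - s) s :=
      (contDiff_id.sub contDiff_const).contMDiff.contMDiffAt
    have h3 := (contMDiffAt_const (c := γ s)).mul (h1.comp (f := fun t : ℝ => t - s) s h2)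
    refine h3.congr_of_eventuallyEq (Filter.Eventually.of_forall fun t => ?_)
    rw [Pi.mul_apply, Function.comp_apply, ← hadd, add_sub_cancel]
  · have h1 := hγ 0
    have h2 : (mulInvariantVectorField (I := 𝓘(ℝ, V)) ξ (γ 0) : V) = ξ := by
      rw [h0, mulInvariantVectorField_one]
    refine h1.congr_mfderiv ?_
    ext
    exact congrArg ((1 : ℝ) • ·) h2

end OneParam

section Exponential

set_option linter.unusedSectionVars false

open Set

variable {V : Type*} [NormedAddCommGroup V] [NormedSpace ℝ V] [FiniteDimensional ℝ V]
  {G : Type*} [TopologicalSpace G] [ChartedSpace V G] [Group G] [LieGroup 𝓘(ℝ, V) ∞ G]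

namespace IsOneParamSubgroup

variable {γ γ' : ℝ → G} {ξ η : V}

theorem comp_mul (h : IsOneParamSubgroup 𝓘(ℝ, V) γ ξ) (t : ℝ) :
    IsOneParamSubgroup 𝓘(ℝ, V) (fun s => γ (t * s)) (t • ξ) := by
  have hl : ContDiff ℝ ∞ (fun s : ℝ => t * s) := contDiff_const.mul contDiff_id
  have hd : HasMFDerivAt 𝓘(ℝ, ℝ) 𝓘(ℝ, ℝ) (fun s : ℝ => t * s) 0
      (t • ContinuousLinearMap.id ℝ ℝ) :=
    ((hasFDerivAt_id (0 : ℝ)).const_mul t).hasMFDerivAt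
  refine of_hasMFDerivAt (fun s s' => ?_) (h.smooth.comp hl.contMDiff)
    ((hasMFDerivAt_comp_of_eq h.hasMFDerivAt_zero hd (mul_zero t)).congr_mfderiv ?_)
  · rw [mul_add, h.map_add]
  · ext
    change (t • (1 : ℝ)) • ξ = (1 : ℝ) • t • ξ
    simp

theorem conj (h : IsOneParamSubgroup 𝓘(ℝ, V) γ ξ) (u : G) :
    IsOneParamSubgroup 𝓘(ℝ, V) (fun s => u * γ s * u⁻¹) (Ad V u ξ) := by
  refine of_hasMFDerivAt (fun s s' => ?_)
    ((contMDiff_const.mul h.smooth).mul contMDiff_const)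
    ((hasMFDerivAt_conj u h.hasMFDerivAt_zero h.map_zero).congr_mfderiv ?_)
  · rw [h.map_add]; group
  · ext
    exact map_smul (Ad V u) (1 : ℝ) ξ

/-- If `[ξ, η] = 0`, then `η` is fixed by the adjoint action of the one-parameter subgroup with
velocity `ξ`. -/
theorem Ad_apply_of_lieBr_eq_zero (h : IsOneParamSubgroup 𝓘(ℝ, V) γ ξ) (hb : lieBr G ξ η = 0)
    (s : ℝ) : Ad V (γ s) η = η := by
  have hd : ∀ s, HasDerivAt (fun s => Ad V (γ s) η) 0 s := by
    intro s
    have h1 := hasDerivAt_Ad_curve h.map_zero h.hasMFDerivAt_zero η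
    have h1' : HasDerivAt (fun s => Ad V (γ s) η) 0 (s - s) := by
      rw [sub_self, ← hb]; exact h1
    have h2 := (Ad V (γ s)).hasFDerivAt.comp_hasDerivAt s (h1'.comp_sub_const s s)
    rw [_root_.map_zero] at h2
    refine h2.congr_of_eventuallyEq (Filter.Eventually.of_forall fun t => ?_)
    rw [Function.comp_apply, ← Ad_mul_apply, ← h.map_add, add_sub_cancel]
  have hc := is_const_of_deriv_eq_zero (fun s => (hd s).differentiableAt) (fun s => (hd s).deriv) s 0
  simpa only [h.map_zero, Ad_one_apply] using hc

theorem commute_of_lieBr_eq_zero [T2Space G] (h : IsOneParamSubgroup 𝓘(ℝ, V) γ ξ)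
    (h' : IsOneParamSubgroup 𝓘(ℝ, V) γ' η) (hb : lieBr G ξ η = 0) (s t : ℝ) :
    Commute (γ s) (γ' t) := by
  have h1 := h'.conj (γ s)
  rw [h.Ad_apply_of_lieBr_eq_zero hb] at h1
  have h2 := congrFun (h1.eq h') t
  exact mul_inv_eq_iff_eq_mul.1 h2

theorem mul (h : IsOneParamSubgroup 𝓘(ℝ, V) γ ξ) (h' : IsOneParamSubgroup 𝓘(ℝ, V) γ' η)
    (hc : ∀ s t, Commute (γ s) (γ' t)) :
    IsOneParamSubgroup 𝓘(ℝ, V) (fun s => γ s * γ' s) (ξ + η) := by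
  refine of_hasMFDerivAt (fun s t => ?_) (h.smooth.mul h'.smooth)
    ((hasMFDerivAt_mul_of_eq_one h.hasMFDerivAt_zero h'.hasMFDerivAt_zero h.map_zero
      h'.map_zero).congr_mfderiv ?_)
  · rw [h.map_add, h'.map_add, mul_assoc, mul_assoc, ← mul_assoc (γ t), (hc t s).eq, mul_assoc]
  · ext
    exact (smul_add (1 : ℝ) ξ η).symm

theorem lieExp_smul [T2Space G] (h : IsOneParamSubgroup 𝓘(ℝ, V) γ ξ) (t : ℝ) :
    lieExp 𝓘(ℝ, V) (t • ξ) = γ t := by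
  have h1 : IsOneParamSubgroup 𝓘(ℝ, V)
      (Classical.epsilon fun γ : ℝ → G => IsOneParamSubgroup 𝓘(ℝ, V) γ (t • ξ)) (t • ξ) :=
    Classical.epsilon_spec (p := fun γ : ℝ → G => IsOneParamSubgroup 𝓘(ℝ, V) γ (t • ξ))
      ⟨_, h.comp_mul t⟩
  have h2 : (lieExp 𝓘(ℝ, V) (t • ξ) : G) = γ (t * 1) := congrFun (h1.eq (h.comp_mul t)) 1
  rwa [mul_one] at h2

end IsOneParamSubgroup

variable [T2Space G]

theorem isOneParamSubgroup_lieExp (ξ : V) :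
    IsOneParamSubgroup 𝓘(ℝ, V) (fun t : ℝ => (lieExp 𝓘(ℝ, V) (t • ξ) : G)) ξ := by
  obtain ⟨γ, h⟩ := exists_isOneParamSubgroup (G := G) ξ
  have : (fun t : ℝ => (lieExp 𝓘(ℝ, V) (t • ξ) : G)) = γ := funext h.lieExp_smul
  rwa [this]

theorem lieExp_zero : (lieExp 𝓘(ℝ, V) (0 : V) : G) = 1 := by
  simpa using (isOneParamSubgroup_lieExp (G := G) (0 : V)).map_zero

theorem lieExp_add {ξ η : V} (hb : lieBr G ξ η = 0) :
    (lieExp 𝓘(ℝ, V) (ξ + η) : G) = lieExp 𝓘(ℝ, V) ξ * lieExp 𝓘(ℝ, V) η := by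
  have h1 := isOneParamSubgroup_lieExp (G := G) ξ
  have h2 := isOneParamSubgroup_lieExp (G := G) η
  have h := (h1.mul h2 (h1.commute_of_lieBr_eq_zero h2 hb)).lieExp_smul 1
  simpa only [one_smul] using h

theorem lieBr_neg (ξ η : V) : lieBr G ξ (-η) = -lieBr G ξ η := by
  have := lieBr_smul G (-1) ξ η
  simpa using this

theorem lieExp_sub {ξ η : V} (hb : lieBr G ξ η = 0) :
    (lieExp 𝓘(ℝ, V) ξ : G) * (lieExp 𝓘(ℝ, V) η)⁻¹ = lieExp 𝓘(ℝ, V) (ξ - η) := by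
  have h1 : lieBr G (ξ - η) η = 0 := by
    rw [lieBr_skew, sub_eq_add_neg, lieBr_add, lieBr_neg, lieBr_self, lieBr_skew, hb]
    simp
  rw [mul_inv_eq_iff_eq_mul, ← lieExp_add h1, sub_add_cancel]

variable {E : Type*} [NormedAddCommGroup E] [NormedSpace ℝ E]

/-- The derivative of `exp` along commuting directions, at a point where the exponent vanishes:
there the exponential is a product of one-parameter subgroups. -/
theorem hasMFDerivAt_lieExp_sum {ι : Type*} (s : Finset ι) (b : ι → V) (t : ι → E → ℝ)
    (t' : ι → E →L[ℝ] ℝ) (x : E) (hb : ∀ i j, lieBr G (b i) (b j) = 0)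
    (ht : ∀ i, HasFDerivAt (t i) (t' i) x) (hx : ∀ i, t i x = 0) :
    HasMFDerivAt 𝓘(ℝ, E) 𝓘(ℝ, V) (fun y => (lieExp 𝓘(ℝ, V) (∑ i ∈ s, t i y • b i) : G)) x
      (∑ i ∈ s, (t' i).smulRight (b i)) := by
  classical
  induction s using Finset.induction_on with
  | empty =>
    simp only [Finset.sum_empty]
    exact hasMFDerivAt_const _ _
  | insert a s ha ih =>
    have h1 : HasMFDerivAt 𝓘(ℝ, E) 𝓘(ℝ, V) (fun y => (lieExp 𝓘(ℝ, V) (t a y • b a) : G)) x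
        ((t' a).smulRight (b a)) := by
      have h := hasMFDerivAt_comp_of_eq (isOneParamSubgroup_lieExp (G := G) (b a)).hasMFDerivAt_zero
        (ht a).hasMFDerivAt (hx a)
      refine h.congr_mfderiv ?_
      ext
      rfl
    have h2 := hasMFDerivAt_mul_of_eq_one h1 ih (by simp [hx, lieExp_zero])
      (by simp [hx, lieExp_zero])
    refine (h2.congr_mfderiv (Finset.sum_insert (f := fun i => (t' i).smulRight (b i)) ha).symm).congr_of_eventuallyEq (Filter.Eventually.of_forall fun y => ?_)
    simp only
    rw [Finset.sum_insert ha]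
    apply lieExp_add
    rw [← lieAd_apply, map_sum]
    refine Finset.sum_eq_zero fun i _ => ?_
    rw [map_smul, lieAd_apply, lieBr_skew, lieBr_smul, hb]
    simp

/-- The logarithmic derivative of `exp` on an abelian subspace of the Lie algebra. -/
theorem hasMFDerivAt_lieExp_mul_inv (W : Submodule ℝ V) (hW : ∀ ξ ∈ W, ∀ η ∈ W, lieBr G ξ η = 0)
    {m : E → V} {m' : E →L[ℝ] V} {x : E} (hm : HasFDerivAt m m' x) (hmW : ∀ y, m y ∈ W) :
    HasMFDerivAt 𝓘(ℝ, E) 𝓘(ℝ, V)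
      (fun y => (lieExp 𝓘(ℝ, V) (m y) : G) * (lieExp 𝓘(ℝ, V) (m x))⁻¹) x m' := by
  -- Coordinates on `W` are restrictions of linear forms on the whole space.
  obtain ⟨P, hP⟩ := W.subtype.exists_leftInverse_of_injective W.ker_subtype
  let B := Module.finBasis ℝ W
  let l : Fin (Module.finrank ℝ W) → V →L[ℝ] ℝ := fun i =>
    LinearMap.toContinuousLinearMap ((B.coord i).comp P)
  have hl : ∀ ξ ∈ W, ∑ i, l i ξ • (B i : V) = ξ := by
    intro ξ hξ
    have hPξ : P ξ = ⟨ξ, hξ⟩ := DFunLike.congr_fun hP ⟨ξ, hξ⟩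
    have h := congrArg W.subtype (B.sum_repr ⟨ξ, hξ⟩)
    rw [map_sum] at h
    refine Eq.trans (Finset.sum_congr rfl fun i _ => ?_) h
    change B.repr (P ξ) i • (B i : V) = _
    rw [hPξ, map_smul]
    rfl
  have hd : ∀ i, HasFDerivAt (fun y => l i (m y - m x)) ((l i).comp m') x := fun i =>
    (l i).hasFDerivAt.comp x (hm.sub_const (m x))
  have h := hasMFDerivAt_lieExp_sum (G := G) Finset.univ (fun i => (B i : V))
    (fun i y => l i (m y - m x)) (fun i => (l i).comp m') x
    (fun i j => hW _ (B i).2 _ (B j).2) hd (fun i => by simp)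
  have hsum : ∑ i, ((l i).comp m').smulRight (B i : V) = m' := by
    have h1 : HasFDerivAt (fun y => ∑ i, l i (m y - m x) • (B i : V))
        (∑ i, ((l i).comp m').smulRight (B i : V)) x :=
      HasFDerivAt.fun_sum fun i _ => (hd i).smul_const (B i : V)
    refine h1.unique ((hm.sub_const (m x)).congr_of_eventuallyEq
      (Filter.Eventually.of_forall fun y => ?_))
    exact hl _ (W.sub_mem (hmW y) (hmW x))
  refine (h.congr_mfderiv hsum).congr_of_eventuallyEq (Filter.Eventually.of_forall fun y => ?_)
  simp only
  rw [lieExp_sub (hW _ (hmW y) _ (hmW x)), hl _ (W.sub_mem (hmW y) (hmW x))]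

end Exponential

/-! ### Ordered products and the coordinate `j` -/

section Products

theorem descProd_zero {K : Type*} [Group K] {N : ℕ} (x : Fin N → K) : descProd x 0 = 1 := by
  simp [descProd]

theorem descProd_succ {K : Type*} [Group K] {N : ℕ} (x : Fin N → K) (i : Fin N) :
    descProd x (i + 1) = x i * descProd x i := by
  simp [descProd, List.take_add_one, List.reverse_append]

theorem map_descProd {K K' : Type*} [Group K] [Group K'] (f : K →* K') {N : ℕ} (x : Fin N → K)
    (m : ℕ) : f (descProd x m) = descProd (fun i => f (x i)) m := by
  have h : List.ofFn (fun i => f (x i)) = (List.ofFn x).map f := List.map_ofFn.symm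
  rw [descProd, descProd, h, ← List.map_take, ← List.map_reverse, map_list_prod]

theorem map_totalHol {K K' : Type*} [Group K] [Group K'] (f : K →* K') {n g : ℕ}
    (M : Fin n → K) (A B : Fin g → K) :
    f (totalHol M A B) = totalHol (fun i => f (M i)) (fun i => f (A i)) (fun i => f (B i)) := by
  simp only [totalHol, map_mul, map_descProd, map_inv]

theorem totalHol_conj {K : Type*} [Group K] {n g : ℕ} (h : K) (M : Fin n → K) (A B : Fin g → K) :
    totalHol (fun i => h * M i * h⁻¹) (fun i => h * A i * h⁻¹) (fun i => h * B i * h⁻¹)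
      = h * totalHol M A B * h⁻¹ :=
  (map_totalHol (MulAut.conj h).toMonoidHom M A B).symm

end Products

section JCoordinate

variable {V : Type*} [NormedAddCommGroup V] [NormedSpace ℝ V] [FiniteDimensional ℝ V]
  {G : Type*} [TopologicalSpace G] [ChartedSpace V G] [Group G] [LieGroup 𝓘(ℝ, V) ∞ G]

namespace CoadjGroup

variable (V G) in
/-- The projection `G ⋉ 𝔤* → G`. -/
def fstHom : CoadjGroup V G →* G where
  toFun p := p.1
  map_one' := rfl
  map_mul' _ _ := rfl

/-- The coordinate `j` is a cocycle for the adjoint action. -/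
theorem j_mul_apply (X Y : CoadjGroup V G) (v : V) :
    (X * Y).j v = X.j (Ad V Y.1 v) + Y.j v := by
  change -((X.2 + coAd V X.1⁻¹ Y.2 : StrongDual ℝ V) (Ad V (X.1 * Y.1) v))
    = -(X.2 (Ad V X.1 (Ad V Y.1 v))) + -(Y.2 (Ad V Y.1 v))
  rw [add_apply, Ad_mul_apply]
  simp only [coAd, ContinuousLinearMap.comp_apply, Ad_inv_apply_Ad]
  ring

theorem j_one : (1 : CoadjGroup V G).j = 0 := by
  ext v
  have := j_mul_apply (1 : CoadjGroup V G) 1 (Ad V (1 : G)⁻¹ v)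
  rw [mul_one] at this
  have h1 : Ad V (1 : CoadjGroup V G).1 (Ad V (1 : G)⁻¹ v) = v := Ad_apply_Ad_inv 1 v
  rw [h1] at this
  simpa using this

theorem j_inv_apply (X : CoadjGroup V G) (v : V) : X⁻¹.j v = -X.j (Ad V X.1⁻¹ v) := by
  have h := j_mul_apply X X⁻¹ v
  rw [mul_inv_cancel, j_one] at h
  exact (neg_eq_of_add_eq_zero_right h.symm).symm

theorem j_conj_apply (h X : CoadjGroup V G) (v : V) :
    (h * X * h⁻¹).j (Ad V h.1 v) = X.j v + h.j (Ad V X.1 v) - h.j v := by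
  have e : Ad V (h⁻¹).1 (Ad V h.1 v) = v := Ad_inv_apply_Ad h.1 v
  rw [j_mul_apply, e, j_mul_apply, j_inv_apply, Ad_inv_apply_Ad]
  ring

end CoadjGroup

end JCoordinate

/-! ### The one-form `Θ` under field-dependent conjugation -/

section ThetaTransform

set_option linter.unusedSectionVars false

open CoadjGroup

variable {V : Type*} [NormedAddCommGroup V] [NormedSpace ℝ V] [FiniteDimensional ℝ V]
  {G : Type*} [TopologicalSpace G] [ChartedSpace V G] [Group G] [LieGroup 𝓘(ℝ, V) ∞ G]
  {E : Type*} [NormedAddCommGroup E] [NormedSpace ℝ E]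

/-- The logarithmic derivative `δf f⁻¹ - Ad(f) λ`, twisted by a `𝔤`-valued form `λ`. It obeys the
same product rule as `δf f⁻¹`. With `λ = u⁻¹ δu` it describes the logarithmic derivative of
`u f u⁻¹`. -/
def twistedLog (lam : E →L[ℝ] V) (f : E → G) (x : E) : E →L[ℝ] V :=
  rightLog 𝓘(ℝ, V) f x - (Ad V (f x)).comp lam

theorem twistedLog_mul (lam : E →L[ℝ] V) {f g : E → G} {x : E}
    (hf : MDifferentiableAt 𝓘(ℝ, E) 𝓘(ℝ, V) f x) (hg : MDifferentiableAt 𝓘(ℝ, E) 𝓘(ℝ, V) g x)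
    (e : E) :
    twistedLog lam (fun y => f y * g y) x e
      = rightLog 𝓘(ℝ, V) f x e + Ad V (f x) (twistedLog lam g x e) := by
  simp only [twistedLog, rightLog_mul hf hg, sub_apply, add_apply,
    ContinuousLinearMap.comp_apply, Ad_mul_apply, map_sub]
  abel

/-- The form `u⁻¹ δu`, written as `Ad(u⁻¹) (δu u⁻¹)`. -/
def adInvLog (u : E → G) (x : E) : E →L[ℝ] V :=
  (Ad V (u x)⁻¹).comp (rightLog 𝓘(ℝ, V) u x)

theorem rightLog_conj {u f : E → G} {x : E}
    (hu : MDifferentiableAt 𝓘(ℝ, E) 𝓘(ℝ, V) u x) (hf : MDifferentiableAt 𝓘(ℝ, E) 𝓘(ℝ, V) f x)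
    (e : E) :
    rightLog 𝓘(ℝ, V) (fun y => u y * f y * (u y)⁻¹) x e
      = Ad V (u x) (adInvLog u x e + twistedLog (adInvLog u x) f x e) := by
  rw [rightLog_mul (mdifferentiableAt_mul hu hf) (mdifferentiableAt_inv hu), rightLog_mul hu hf,
    rightLog_inv hu]
  simp only [twistedLog, adInvLog, sub_apply, add_apply, neg_apply,
    ContinuousLinearMap.comp_apply, Ad_mul_apply, map_sub, map_add, map_neg, Ad_apply_Ad_inv]
  abel

theorem rightLog_mul_left_eq {u f : E → G} {x : E}
    (hu : MDifferentiableAt 𝓘(ℝ, E) 𝓘(ℝ, V) u x) (hf : MDifferentiableAt 𝓘(ℝ, E) 𝓘(ℝ, V) f x)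
    (e : E) :
    rightLog 𝓘(ℝ, V) (fun y => u y * f y) x e
      = Ad V (u x) (adInvLog u x e + rightLog 𝓘(ℝ, V) f x e) := by
  rw [rightLog_mul hu hf]
  simp [adInvLog]

theorem mdifferentiableAt_descProd {N : ℕ} {f : Fin N → E → G} {x : E}
    (hf : ∀ i, MDifferentiableAt 𝓘(ℝ, E) 𝓘(ℝ, V) (f i) x) {m : ℕ} (hm : m ≤ N) :
    MDifferentiableAt 𝓘(ℝ, E) 𝓘(ℝ, V) (fun y => descProd (fun i => f i y) m) x := by
  induction m with
  | zero => simp only [descProd_zero]; exact mdifferentiableAt_const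
  | succ m ih =>
    have h : (fun y => descProd (fun i => f i y) (m + 1))
        = fun y => f ⟨m, hm⟩ y * descProd (fun i => f i y) m := by
      funext y
      exact descProd_succ (fun i => f i y) ⟨m, hm⟩
    rw [h]
    exact mdifferentiableAt_mul (hf _) (ih (Nat.le_of_succ_le hm))

theorem sum_fin_sub_telescope (N : ℕ) (F : ℕ → ℝ) :
    ∑ i : Fin N, (F (i + 1) - F i) = F N - F 0 := by
  rw [Fin.sum_univ_eq_sum_range (fun i => F (i + 1) - F i), Finset.sum_range_sub]

/-- The change of one summand of `Θ` belonging to a puncture. -/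
theorem puncture_term_conj {u v m U : E → G} {x : E} (h X : CoadjGroup V G) (c : G)
    (hh : h.1 = u x) (hX : X.1 = m x) (hm : ∀ y, m y = v y * c * (v y)⁻¹)
    (hu : MDifferentiableAt 𝓘(ℝ, E) 𝓘(ℝ, V) u x) (hv : MDifferentiableAt 𝓘(ℝ, E) 𝓘(ℝ, V) v x)
    (hU : MDifferentiableAt 𝓘(ℝ, E) 𝓘(ℝ, V) U x) (e : E) :
    (h * X * h⁻¹).j (rightLog 𝓘(ℝ, V) (fun y => u y * U y * (u y)⁻¹) x e
        - rightLog 𝓘(ℝ, V) (fun y => u y * v y) x e)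
      = X.j (rightLog 𝓘(ℝ, V) U x e - rightLog 𝓘(ℝ, V) v x e)
        - X.j (Ad V (U x) (adInvLog u x e))
        + h.j (twistedLog (adInvLog u x) (fun y => m y * U y) x e)
        - h.j (twistedLog (adInvLog u x) U x e) := by
  have hmf : m = fun y => v y * c * (v y)⁻¹ := funext hm
  have hmd : MDifferentiableAt 𝓘(ℝ, E) 𝓘(ℝ, V) m x := by
    rw [hmf]
    exact mdifferentiableAt_mul (mdifferentiableAt_mul hv mdifferentiableAt_const)
      (mdifferentiableAt_inv hv)
  -- `δm m⁻¹ = δv v⁻¹ - Ad(m) δv v⁻¹`, as `m` moves in a fixed conjugacy class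
  have hml : rightLog 𝓘(ℝ, V) m x e
      = rightLog 𝓘(ℝ, V) v x e - Ad V (m x) (rightLog 𝓘(ℝ, V) v x e) := by
    rw [hmf, rightLog_mul (mdifferentiableAt_mul hv mdifferentiableAt_const)
      (mdifferentiableAt_inv hv), rightLog_mul hv mdifferentiableAt_const, rightLog_inv hv,
      rightLog_const]
    simp only [add_apply, neg_apply, zero_apply, ContinuousLinearMap.comp_apply, Ad_mul_apply,
      map_neg, map_zero]
    abel
  rw [rightLog_conj hu hU, rightLog_mul_left_eq hu hv, ← map_sub, ← hh, j_conj_apply,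
    twistedLog_mul _ hmd hU, hml, hX]
  simp only [twistedLog, sub_apply, ContinuousLinearMap.comp_apply, map_sub, map_add]
  ring

/-- The change of the two summands of `Θ` belonging to a handle. -/
theorem handle_term_conj {u a b P : E → G} {x : E} (h A B : CoadjGroup V G)
    (hh : h.1 = u x) (hA : A.1 = a x) (hB : B.1 = b x)
    (hu : MDifferentiableAt 𝓘(ℝ, E) 𝓘(ℝ, V) u x) (ha : MDifferentiableAt 𝓘(ℝ, E) 𝓘(ℝ, V) a x)
    (hb : MDifferentiableAt 𝓘(ℝ, E) 𝓘(ℝ, V) b x) (hP : MDifferentiableAt 𝓘(ℝ, E) 𝓘(ℝ, V) P x)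
    (e : E) {Q R : E → G} (hQ : Q = fun y => (a y)⁻¹ * (b y)⁻¹ * a y * P y)
    (hR : R = fun y => (b y)⁻¹ * a y * P y) :
    (h * A * h⁻¹).j (rightLog 𝓘(ℝ, V) (fun y => u y * P y * (u y)⁻¹) x e
        - rightLog 𝓘(ℝ, V) (fun y => u y * Q y * (u y)⁻¹) x e)
      + (h * B * h⁻¹).j (rightLog 𝓘(ℝ, V) (fun y => u y * Q y * (u y)⁻¹) x e
        - rightLog 𝓘(ℝ, V) (fun y => u y * R y * (u y)⁻¹) x e)
      = A.j (rightLog 𝓘(ℝ, V) P x e - rightLog 𝓘(ℝ, V) Q x e)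
        + B.j (rightLog 𝓘(ℝ, V) Q x e - rightLog 𝓘(ℝ, V) R x e)
        - (B * A⁻¹ * B⁻¹ * A).j (Ad V (P x) (adInvLog u x e))
        + h.j (twistedLog (adInvLog u x) (fun y => b y * (a y)⁻¹ * (b y)⁻¹ * a y * P y) x e)
        - h.j (twistedLog (adInvLog u x) P x e) := by
  have hQd : MDifferentiableAt 𝓘(ℝ, E) 𝓘(ℝ, V) Q x := by
    rw [hQ]
    exact mdifferentiableAt_mul (mdifferentiableAt_mul (mdifferentiableAt_mul
      (mdifferentiableAt_inv ha) (mdifferentiableAt_inv hb)) ha) hP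
  have hRd : MDifferentiableAt 𝓘(ℝ, E) 𝓘(ℝ, V) R x := by
    rw [hR]
    exact mdifferentiableAt_mul (mdifferentiableAt_mul (mdifferentiableAt_inv hb) ha) hP
  set lam : E →L[ℝ] V := adInvLog u x
  -- the relations `a P = b R`, `a Q = R` and `b a⁻¹ b⁻¹ a P = b Q`
  have h1 : (fun y => a y * P y) = fun y => b y * R y := by
    funext y; simp [hR, mul_assoc]
  have h2 : (fun y => a y * Q y) = R := by
    funext y; simp [hQ, hR, mul_assoc]
  have h3 : (fun y => b y * (a y)⁻¹ * (b y)⁻¹ * a y * P y) = fun y => b y * Q y := by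
    funext y; simp [hQ, mul_assoc]
  have t1 := congrArg (fun f => twistedLog lam f x e) h1
  have t2 := congrArg (fun f => twistedLog lam f x e) h2
  simp only [twistedLog_mul lam ha hP, twistedLog_mul lam hb hRd] at t1
  simp only [twistedLog_mul lam ha hQd] at t2
  rw [h3, twistedLog_mul lam hb hQd, rightLog_conj hu hP, rightLog_conj hu hQd,
    rightLog_conj hu hRd, ← map_sub, ← map_sub, ← hh, j_conj_apply, j_conj_apply, hA, hB]
  have k1 : Ad V (a x) (twistedLog lam P x e) = rightLog 𝓘(ℝ, V) b x e
      + Ad V (b x) (twistedLog lam R x e) - rightLog 𝓘(ℝ, V) a x e := by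
    rw [← t1]; abel
  have k2 : Ad V (a x) (twistedLog lam Q x e)
      = twistedLog lam R x e - rightLog 𝓘(ℝ, V) a x e := by
    rw [← t2]; abel
  have hj : ∀ w : V, (B * A⁻¹ * B⁻¹ * A).j (Ad V (P x) w)
      = A.j (Ad V (P x) w - Ad V (Q x) w) + B.j (Ad V (Q x) w - Ad V (R x) w) := by
    intro w
    have eA : ∀ z : V, Ad V (A⁻¹).1 z = Ad V (a x)⁻¹ z := by intro z; rw [← hA]; rfl
    have eB : ∀ z : V, Ad V (B⁻¹).1 z = Ad V (b x)⁻¹ z := by intro z; rw [← hB]; rfl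
    simp only [j_mul_apply, j_inv_apply, eA, eB, hA, hB, hQ, hR, Ad_mul_apply, map_sub]
    ring
  rw [hj]
  have l1 : adInvLog u x e + twistedLog lam P x e - (adInvLog u x e + twistedLog lam Q x e)
      = twistedLog lam P x e - twistedLog lam Q x e := by abel
  have l2 : adInvLog u x e + twistedLog lam Q x e - (adInvLog u x e + twistedLog lam R x e)
      = twistedLog lam Q x e - twistedLog lam R x e := by abel
  rw [l1, l2]
  simp only [map_sub (Ad V (a x)), k1, k2, map_sub (Ad V (b x))]
  simp only [map_sub, map_add]
  simp only [twistedLog, sub_apply, ContinuousLinearMap.comp_apply, map_sub]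
  ring

end ThetaTransform

section ThetaGauge

set_option linter.unusedSectionVars false

open CoadjGroup

variable {V : Type*} [NormedAddCommGroup V] [NormedSpace ℝ V] [FiniteDimensional ℝ V]
  {G : Type*} [TopologicalSpace G] [ChartedSpace V G] [Group G] [LieGroup 𝓘(ℝ, V) ∞ G]
  {E : Type*} [NormedAddCommGroup E] [NormedSpace ℝ E]

/-- The change of `Θ` under a field-dependent conjugation: it only involves the ordered product of
all holonomies, since the contributions of punctures and handles telescope. -/
theorem Theta_conj {n g : ℕ} {h : E → CoadjGroup V G} {v : Fin n → E → G} {c : Fin n → G}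
    {M : Fin n → E → CoadjGroup V G} {A B : Fin g → E → CoadjGroup V G} {x : E}
    (hM : ∀ i y, (M i y).1 = v i y * c i * (v i y)⁻¹)
    (hh : MDifferentiableAt 𝓘(ℝ, E) 𝓘(ℝ, V) (fun y => (h y).1) x)
    (hv : ∀ i, MDifferentiableAt 𝓘(ℝ, E) 𝓘(ℝ, V) (v i) x)
    (hA : ∀ i, MDifferentiableAt 𝓘(ℝ, E) 𝓘(ℝ, V) (fun y => (A i y).1) x)
    (hB : ∀ i, MDifferentiableAt 𝓘(ℝ, E) 𝓘(ℝ, V) (fun y => (B i y).1) x) (e : E) :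
    Theta (fun i y => (h y).1 * v i y) (fun i y => h y * M i y * (h y)⁻¹)
        (fun i y => h y * A i y * (h y)⁻¹) (fun i y => h y * B i y * (h y)⁻¹) x e
      = Theta v M A B x e
        + (h x).j (twistedLog (adInvLog (fun y => (h y).1) x)
            (fun y => (totalHol (fun i => M i y) (fun i => A i y) (fun i => B i y)).1) x e
          + adInvLog (fun y => (h y).1) x e)
        - (totalHol (fun i => M i x) (fun i => A i x) (fun i => B i x)).j
            (adInvLog (fun y => (h y).1) x e) := by
  set u : E → G := fun y => (h y).1 with hu
  have hMd : ∀ i, MDifferentiableAt 𝓘(ℝ, E) 𝓘(ℝ, V) (fun y => (M i y).1) x := by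
    intro i
    have : (fun y => (M i y).1) = fun y => v i y * c i * (v i y)⁻¹ := funext (hM i)
    rw [this]
    exact mdifferentiableAt_mul (mdifferentiableAt_mul (hv i) mdifferentiableAt_const)
      (mdifferentiableAt_inv (hv i))
  let U : ℕ → E → G := fun m y => descProd (fun k => (M k y).1) m
  let H : Fin g → E → CoadjGroup V G := fun k y => B k y * (A k y)⁻¹ * (B k y)⁻¹ * A k y
  let P : ℕ → E → G := fun m y => descProd (fun k => (H k y).1) m * U n y
  have hU : ∀ m, m ≤ n → MDifferentiableAt 𝓘(ℝ, E) 𝓘(ℝ, V) (U m) x := fun m hm =>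
    mdifferentiableAt_descProd hMd hm
  have hP : ∀ m, m ≤ g → MDifferentiableAt 𝓘(ℝ, E) 𝓘(ℝ, V) (P m) x := fun m hm =>
    mdifferentiableAt_mul (mdifferentiableAt_descProd (fun i => mdifferentiableAt_mul
      (mdifferentiableAt_mul (mdifferentiableAt_mul (hB i) (mdifferentiableAt_inv (hA i)))
        (mdifferentiableAt_inv (hB i))) (hA i)) hm) (hU n le_rfl)
  let F : ℕ → ℝ := fun m => (h x).j (twistedLog (adInvLog u x) (U m) x e)
    - (descProd (fun k => M k x) m).j (adInvLog u x e)
  let F' : ℕ → ℝ := fun m => (h x).j (twistedLog (adInvLog u x) (P m) x e)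
    - (descProd (fun k => H k x) m * descProd (fun k => M k x) n).j (adInvLog u x e)
  have hconj : ∀ (m : ℕ) (y : E), descProd (fun k => (h y * M k y * (h y)⁻¹).1) m
      = u y * U m y * (u y)⁻¹ := fun m y =>
    (map_descProd (MulAut.conj (u y)).toMonoidHom (fun k => (M k y).1) m).symm
  have hconj' : ∀ (m : ℕ) (y : E), descProd (fun k => (h y * B k y * (h y)⁻¹).1
        * ((h y * A k y * (h y)⁻¹).1)⁻¹ * ((h y * B k y * (h y)⁻¹).1)⁻¹
        * (h y * A k y * (h y)⁻¹).1) m * (u y * U n y * (u y)⁻¹)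
      = u y * P m y * (u y)⁻¹ := by
    intro m y
    have e1 : (fun k => (h y * B k y * (h y)⁻¹).1
        * ((h y * A k y * (h y)⁻¹).1)⁻¹ * ((h y * B k y * (h y)⁻¹).1)⁻¹
        * (h y * A k y * (h y)⁻¹).1) = fun k => u y * (H k y).1 * (u y)⁻¹ := by
      funext k
      change (u y * (B k y).1 * (u y)⁻¹) * (u y * (A k y).1 * (u y)⁻¹)⁻¹
        * (u y * (B k y).1 * (u y)⁻¹)⁻¹ * (u y * (A k y).1 * (u y)⁻¹)
        = u y * ((B k y).1 * (A k y).1⁻¹ * (B k y).1⁻¹ * (A k y).1) * (u y)⁻¹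
      group
    have e2 := (map_descProd (MulAut.conj (u y)).toMonoidHom (fun k => (H k y).1) m).symm
    rw [e1]
    refine (congrArg (· * (u y * U n y * (u y)⁻¹)) e2).trans ?_
    change u y * _ * (u y)⁻¹ * _ = u y * (_ * U n y) * (u y)⁻¹
    group
  have hpunct : ∀ i : Fin n,
      (h x * M i x * (h x)⁻¹).j (rightLog 𝓘(ℝ, V) (fun y => u y * U i y * (u y)⁻¹) x e
        - rightLog 𝓘(ℝ, V) (fun y => u y * v i y) x e)
      = (M i x).j (rightLog 𝓘(ℝ, V) (U i) x e - rightLog 𝓘(ℝ, V) (v i) x e)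
        + (F (i + 1) - F i) := by
    intro i
    have e1 : U (i + 1) = fun y => (M i y).1 * U i y :=
      funext fun y => descProd_succ (fun k => (M k y).1) i
    have e2 : Ad V (descProd (fun k => M k x) i).1 = Ad V (U i x) :=
      congrArg (Ad V) (map_descProd (fstHom V G) (fun k => M k x) i)
    rw [puncture_term_conj (u := u) (m := fun y => (M i y).1) (x := x) (h x) (M i x) (c i) rfl rfl (hM i) hh (hv i) (hU i i.2.le)]
    simp only [F]
    rw [descProd_succ, j_mul_apply, e1, e2]
    ring
  have hhandle : ∀ i : Fin g, _ := fun i => handle_term_conj (x := x) (h x) (A i x) (B i x)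
    (u := u) rfl rfl rfl hh (hA i) (hB i) (hP i i.2.le) e rfl rfl
  have hstep : ∀ i : Fin g,
      - (B i x * (A i x)⁻¹ * (B i x)⁻¹ * A i x).j (Ad V (P i x) (adInvLog u x e))
        + (h x).j (twistedLog (adInvLog u x) (fun y => (B i y).1 * (A i y).1⁻¹ * (B i y).1⁻¹
            * (A i y).1 * P i y) x e)
        - (h x).j (twistedLog (adInvLog u x) (P i) x e) = F' (i + 1) - F' i := by
    intro i
    have e1 : P (i + 1) = fun y => (B i y).1 * (A i y).1⁻¹ * (B i y).1⁻¹
            * (A i y).1 * P i y := by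
      funext y
      have := descProd_succ (fun k => (H k y).1) i
      simp only [P]
      rw [this, mul_assoc]
      rfl
    have e2 : Ad V (descProd (fun k => H k x) i * descProd (fun k => M k x) n).1
        = Ad V (P i x) :=
      congrArg (Ad V) (congrArg₂ (· * ·) (map_descProd (fstHom V G) (fun k => H k x) i)
        (map_descProd (fstHom V G) (fun k => M k x) n))
    simp only [F']
    rw [descProd_succ, mul_assoc (H i x), j_mul_apply (H i x), e1, e2]
    ring
  have hend : P g = fun y =>
      (totalHol (fun i => M i y) (fun i => A i y) (fun i => B i y)).1 := by
    funext y
    exact (congrArg₂ (· * ·) (map_descProd (fstHom V G) (fun k => H k y) g)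
        (map_descProd (fstHom V G) (fun k => M k y) n)).symm
  have hF0 : F 0 = -(h x).j (adInvLog u x e) := by
    have e1 : U 0 = fun _ => 1 := funext fun y => descProd_zero _
    simp only [F]
    rw [e1, descProd_zero, j_one]
    simp [twistedLog, rightLog_const, Ad_one_apply]
  have hF'0 : F' 0 = F n := by
    have e1 : P 0 = U n := by
      funext y
      simp only [P]
      rw [descProd_zero, one_mul]
    simp only [F, F']
    rw [e1, descProd_zero, one_mul]
  have hQ : ∀ (i : Fin g) (y : E), ((h y * A i y * (h y)⁻¹).1)⁻¹ * ((h y * B i y * (h y)⁻¹).1)⁻¹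
        * (h y * A i y * (h y)⁻¹).1 * (u y * P i y * (u y)⁻¹)
      = u y * ((A i y).1⁻¹ * (B i y).1⁻¹ * (A i y).1 * P i y) * (u y)⁻¹ := by
    intro i y
    change (u y * (A i y).1 * (u y)⁻¹)⁻¹ * (u y * (B i y).1 * (u y)⁻¹)⁻¹
      * (u y * (A i y).1 * (u y)⁻¹) * (u y * P i y * (u y)⁻¹) = _
    group
  have hR : ∀ (i : Fin g) (y : E), ((h y * B i y * (h y)⁻¹).1)⁻¹
        * (h y * A i y * (h y)⁻¹).1 * (u y * P i y * (u y)⁻¹)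
      = u y * ((B i y).1⁻¹ * (A i y).1 * P i y) * (u y)⁻¹ := by
    intro i y
    change (u y * (B i y).1 * (u y)⁻¹)⁻¹
      * (u y * (A i y).1 * (u y)⁻¹) * (u y * P i y * (u y)⁻¹) = _
    group
  have s1 := Finset.sum_congr (s₁ := Finset.univ) rfl fun i _ => hpunct i
  rw [Finset.sum_add_distrib, sum_fin_sub_telescope] at s1
  have s2 := Finset.sum_congr (s₁ := Finset.univ) rfl fun i _ => hstep i
  rw [sum_fin_sub_telescope] at s2
  have s3 := Finset.sum_congr (s₁ := Finset.univ) rfl fun i _ => hhandle i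
  simp only [Finset.sum_add_distrib, Finset.sum_sub_distrib, Finset.sum_neg_distrib] at s2 s3
  have hFg : F' g = (h x).j (twistedLog (adInvLog u x)
      (fun y => (totalHol (fun i => M i y) (fun i => A i y) (fun i => B i y)).1) x e)
      - (totalHol (fun i => M i x) (fun i => A i x) (fun i => B i x)).j (adInvLog u x e) := by
    rw [← hend]
    rfl
  have hΘ : Theta v M A B x e
      = ∑ i, (M i x).j (rightLog 𝓘(ℝ, V) (U i) x e - rightLog 𝓘(ℝ, V) (v i) x e)
        + ∑ i, (A i x).j (rightLog 𝓘(ℝ, V) (P i) x e - rightLog 𝓘(ℝ, V)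
            (fun y => (A i y).1⁻¹ * (B i y).1⁻¹ * (A i y).1 * P i y) x e)
        + ∑ i, (B i x).j (rightLog 𝓘(ℝ, V)
            (fun y => (A i y).1⁻¹ * (B i y).1⁻¹ * (A i y).1 * P i y) x e - rightLog 𝓘(ℝ, V)
            (fun y => (B i y).1⁻¹ * (A i y).1 * P i y) x e) := by
    simp only [Theta, add_apply, sum_apply, ContinuousLinearMap.comp_apply, sub_apply]
    rfl
  rw [hΘ]
  simp only [Theta, add_apply, sum_apply, ContinuousLinearMap.comp_apply, sub_apply, hconj, hconj',
    hQ, hR]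
  rw [map_add]
  rw [hF0, ← hF'0] at s1
  linarith

end ThetaGauge

/-! ### Exterior derivatives of one-forms -/

section ExteriorDerivative

variable {E : Type*} [NormedAddCommGroup E] [NormedSpace ℝ E]

theorem extD_congr {θ θ' : E → E →L[ℝ] ℝ} {x : E} (h : θ =ᶠ[𝓝 x] θ') : extD θ x = extD θ' x := by
  apply Filter.EventuallyEq.extDeriv_eq
  filter_upwards [h] with y hy
  rw [hy]

theorem extD_fderiv {f : E → ℝ} {x : E} (hf : ContDiffAt ℝ ∞ f x) :
    extD (fun y => fderiv ℝ f y) x = 0 := by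
  have h1 : (fun y => ContinuousAlternatingMap.ofSubsingleton ℝ E ℝ (0 : Fin 1) (fderiv ℝ f y))
      = extDeriv (fun y => ContinuousAlternatingMap.constOfIsEmpty ℝ E (Fin 0) (f y)) := by
    funext y
    exact (extDeriv_constOfIsEmpty f y).symm
  unfold extD
  rw [h1]
  refine extDeriv_extDeriv_apply (r := ∞) ?_ ?_
  · exact (ContinuousAlternatingMap.constOfIsEmptyLIE ℝ E ℝ (Fin 0)).contDiff.contDiffAt.comp x hf
  · rw [minSmoothness_of_isRCLikeNormedField]; exact ENat.LEInfty.out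

/-- Adding an exact form does not change the exterior derivative. No differentiability of `θ` is
needed: the two forms are differentiable at the same points. -/
theorem extD_add_fderiv (θ : E → E →L[ℝ] ℝ) {f : E → ℝ} {x : E} (hf : ContDiffAt ℝ ∞ f x) :
    extD (fun y => θ y + fderiv ℝ f y) x = extD θ x := by
  have h0 := extD_fderiv hf
  unfold extD at h0 ⊢
  set η : E → E [⋀^Fin 1]→L[ℝ] ℝ :=
    fun y => ContinuousAlternatingMap.ofSubsingleton ℝ E ℝ (0 : Fin 1) (θ y)
  set η' : E → E [⋀^Fin 1]→L[ℝ] ℝ :=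
    fun y => ContinuousAlternatingMap.ofSubsingleton ℝ E ℝ (0 : Fin 1) (fderiv ℝ f y) with hη'
  have hd : DifferentiableAt ℝ η' x := by
    have h1 : DifferentiableAt ℝ (fderiv ℝ f) x :=
      (hf.fderiv_right (m := 1) (by norm_cast)).differentiableAt (by simp)
    exact (ContinuousAlternatingMap.ofSubsingletonLIE (𝕜 := ℝ) (E := E) (F := ℝ)
      (0 : Fin 1)).toContinuousLinearEquiv.differentiableAt.comp
      x h1
  have hs : (fun y => ContinuousAlternatingMap.ofSubsingleton ℝ E ℝ (0 : Fin 1)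
      (θ y + fderiv ℝ f y)) = η + η' := by
    funext y
    ext v
    simp [η, η']
  rw [hs]
  by_cases hη : DifferentiableAt ℝ η x
  · rw [extDeriv_add hη hd, h0, add_zero]
  · have h2 : ¬ DifferentiableAt ℝ (η + η') x := fun h => hη (by simpa using h.sub hd)
    rw [extDeriv, extDeriv, fderiv_zero_of_not_differentiableAt hη,
      fderiv_zero_of_not_differentiableAt h2]

theorem fderiv_comp_snd_apply_inl (f : E → ℝ) (p : ℝ × E) :
    fderiv ℝ (fun q : ℝ × E => f q.2) p (1, 0) = 0 := by
  by_cases h : DifferentiableAt ℝ (fun q : ℝ × E => f q.2) p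
  · have h1 : HasFDerivAt (fun t : ℝ => f p.2)
        ((fderiv ℝ (fun q : ℝ × E => f q.2) p).comp (ContinuousLinearMap.inl ℝ ℝ E)) p.1 :=
      HasFDerivAt.comp (f := fun t : ℝ => (t, p.2)) p.1 h.hasFDerivAt
        (hasFDerivAt_prodMk_left p.1 p.2)
    exact DFunLike.congr_fun (h1.unique (hasFDerivAt_const _ _)) 1
  · rw [fderiv_zero_of_not_differentiableAt h]
    rfl

/-- The exterior derivative of a form pulled back along the projection `ℝ × E → E` is annihilated
by the directions of the fibres. -/
theorem extD_comp_snd_apply (θ : E → E →L[ℝ] ℝ) (p a : ℝ × E) :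
    extD (fun q : ℝ × E => (θ q.2).comp (ContinuousLinearMap.snd ℝ ℝ E)) p ![(1, 0), a] = 0 := by
  unfold extD
  set η : ℝ × E → (ℝ × E) [⋀^Fin 1]→L[ℝ] ℝ := fun q =>
    ContinuousAlternatingMap.ofSubsingleton ℝ (ℝ × E) ℝ (0 : Fin 1)
      ((θ q.2).comp (ContinuousLinearMap.snd ℝ ℝ E)) with hη
  by_cases h : DifferentiableAt ℝ η p
  · rw [extDeriv_apply h, Fin.sum_univ_two]
    have h1 : (fun q => η q ((0 : Fin 2).removeNth ![(1, 0), a])) = fun q => θ q.2 a.2 := by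
      funext q
      simp [hη]
    have h2 : (fun q => η q ((1 : Fin 2).removeNth ![(1, 0), a])) = fun _ => 0 := by
      funext q
      simp [hη, Fin.removeNth]
    rw [h1, h2]
    have h3 := fderiv_comp_snd_apply_inl (fun y => θ y a.2) p
    simp [h3]
  · rw [extDeriv, fderiv_zero_of_not_differentiableAt h]
    rw [ContinuousAlternatingMap.alternatizeUncurryFin_apply]
    simp

end ExteriorDerivative

/-! ### The symplectic potential under gauge transformations -/

section Potential

set_option linter.unusedSectionVars false

open CoadjGroup

variable {V : Type*} [NormedAddCommGroup V] [NormedSpace ℝ V] [FiniteDimensional ℝ V]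
  {G : Type*} [TopologicalSpace G] [ChartedSpace V G] [Group G] [LieGroup 𝓘(ℝ, V) ∞ G]
  {E : Type*} [NormedAddCommGroup E] [NormedSpace ℝ E]

variable {n g : ℕ} {c : LieSubalgebra ℝ (CoadjAlg V G)} (D₀ : Fin n → CoadjAlg V G)

theorem ExtPhase.gauge_M (h : CoadjGroup V G) (p : ExtPhase n g c) (i : Fin n) :
    (p.gauge h).M D₀ i = h * p.M D₀ i * h⁻¹ := by
  simp only [ExtPhase.M, ExtPhase.gauge]
  group

theorem ExtPhase.gauge_invK (h : CoadjGroup V G) (p : ExtPhase n g c) :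
    (p.gauge h).invK D₀ = h * p.invK D₀ * h⁻¹ := by
  have e : (p.gauge h).M D₀ = fun i => h * p.M D₀ i * h⁻¹ := funext (p.gauge_M D₀ h)
  unfold ExtPhase.invK
  rw [e]
  exact totalHol_conj h _ _ _

theorem ExtPhase.gauge_mem_constraintSurface (h : CoadjGroup V G) {p : ExtPhase n g c}
    (hp : p ∈ ExtPhase.constraintSurface D₀) : p.gauge h ∈ ExtPhase.constraintSurface D₀ := by
  change (p.gauge h).invK D₀ = h * p.gInf * expNeg (p.D : CoadjAlg V G) * (h * p.gInf)⁻¹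
  have hp' : p.invK D₀ = p.gInf * expNeg (p.D : CoadjAlg V G) * p.gInf⁻¹ := hp
  rw [p.gauge_invK, hp']
  group

theorem contMDiff_coadjGroup_fst :
    ContMDiff (CoadjGroup.model V) 𝓘(ℝ, V) ∞ (fun p : CoadjGroup V G => p.1) :=
  (contMDiff_fst : ContMDiff ((𝓘(ℝ, V)).prod 𝓘(ℝ, StrongDual ℝ V)) 𝓘(ℝ, V) ∞
    (Prod.fst : G × StrongDual ℝ V → G))

theorem mdifferentiableAt_fst_of_contMDiffOn {U : Set E} {f : E → CoadjGroup V G} {x : E}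
    (hf : ContMDiffOn 𝓘(ℝ, E) (CoadjGroup.model V) ∞ f U) (hU : IsOpen U) (hx : x ∈ U) :
    MDifferentiableAt 𝓘(ℝ, E) 𝓘(ℝ, V) (fun y => (f y).1) x :=
  ((contMDiff_coadjGroup_fst.comp_contMDiffOn hf).contMDiffAt (hU.mem_nhds hx)).mdifferentiableAt
    (by simp)

/-- The projection `𝔤 ⊕ 𝔤* → 𝔤`. -/
def coadjAlgFst : CoadjAlg V G →L[ℝ] V :=
  (ContinuousLinearMap.fst ℝ V (StrongDual ℝ V) : V × StrongDual ℝ V →L[ℝ] V)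

/-- The projection `𝔤 ⊕ 𝔤* → 𝔤*`. -/
def coadjAlgSnd : CoadjAlg V G →L[ℝ] StrongDual ℝ V :=
  (ContinuousLinearMap.snd ℝ V (StrongDual ℝ V) : V × StrongDual ℝ V →L[ℝ] StrongDual ℝ V)

theorem lieBr_fst_eq_zero [IsLieAbelian c] {p q : CoadjAlg V G} (hp : p ∈ c) (hq : q ∈ c) :
    lieBr G p.1 q.1 = 0 := by
  have h := trivial_lie_zero c c ⟨p, hp⟩ ⟨q, hq⟩
  have h2 : ⁅p, q⁆ = 0 := congrArg Subtype.val h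
  exact congrArg Prod.fst h2

/-- `δ(e^{-μ}) e^{μ} = -δμ`, since `𝔠` is abelian. -/
theorem hasMFDerivAt_expNeg [T2Space G] [IsLieAbelian c] {D : E → c} {x : E}
    (hD : DifferentiableAt ℝ (fun y => (D y : CoadjAlg V G).1) x) :
    HasMFDerivAt 𝓘(ℝ, E) 𝓘(ℝ, V) (fun y => (expNeg (D y : CoadjAlg V G)).1
        * ((expNeg (D x : CoadjAlg V G)).1)⁻¹) x
      (-fderiv ℝ (fun y => (D y : CoadjAlg V G).1) x) := by
  refine hasMFDerivAt_lieExp_mul_inv (c.toSubmodule.map (coadjAlgFst (V := V) (G := G)).toLinearMap)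
    ?_ hD.hasFDerivAt.neg ?_
  · rintro _ ⟨p, hp, rfl⟩ _ ⟨q, hq, rfl⟩
    exact lieBr_fst_eq_zero hp hq
  · intro y
    exact Submodule.neg_mem _ ⟨_, (D y).2, rfl⟩

theorem potential_apply (φ : E → ExtPhase n g c) (x e : E) :
    potential D₀ φ x e = wForm φ x e
      + Theta (fun i y => ((φ y).gM i).1) (fun i y => (φ y).M D₀ i) (fun i y => (φ y).A i)
          (fun i y => (φ y).B i) x e
      + ((φ x).invK D₀).j (rightLog 𝓘(ℝ, V) (fun y => (φ y).gInf.1) x e)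
      + (φ x).gInf.j (dMu φ x e) + (1 / 2 : ℝ) * ((φ x).D : CoadjAlg V G).2 (dMu φ x e) := by
  have hj : (φ x).gInf.j (dMu φ x e) = -coAd V (φ x).gInf.1 (φ x).gInf.2 (dMu φ x e) := rfl
  rw [hj]
  simp only [potential, add_apply, sub_apply, smul_apply, ContinuousLinearMap.comp_apply,
    smul_eq_mul]
  ring

/-- The symplectic potential is invariant under field-dependent gauge transformations of families
of points of the constraint surface. -/
theorem potential_gauge [T2Space G] [IsLieAbelian c] {U : Set E} {φ : E → ExtPhase n g c}
    (hU : IsOpen U) (hφ : IsSmoothFamily U φ)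
    (hC : ∀ x ∈ U, φ x ∈ ExtPhase.constraintSurface D₀) {h : E → CoadjGroup V G} {x : E}
    (hx : x ∈ U) (hh : MDifferentiableAt 𝓘(ℝ, E) 𝓘(ℝ, V) (fun y => (h y).1) x) :
    potential D₀ (fun y => (φ y).gauge (h y)) x = potential D₀ φ x := by
  ext e
  have hgM := fun i => mdifferentiableAt_fst_of_contMDiffOn (hφ.gM i) hU hx
  have hA := fun i => mdifferentiableAt_fst_of_contMDiffOn (hφ.A i) hU hx
  have hB := fun i => mdifferentiableAt_fst_of_contMDiffOn (hφ.B i) hU hx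
  have hv := mdifferentiableAt_fst_of_contMDiffOn hφ.gInf hU hx
  have hD : DifferentiableAt ℝ (fun y => ((φ y).D : CoadjAlg V G).1) x :=
    (coadjAlgFst (V := V) (G := G)).differentiableAt.comp x
      ((hφ.D.contDiffAt (hU.mem_nhds hx)).differentiableAt (by simp))
  have hE := hasMFDerivAt_expNeg (D := fun y => (φ y).D) hD
  have hEd : MDifferentiableAt 𝓘(ℝ, E) 𝓘(ℝ, V)
      (fun y => (expNeg ((φ y).D : CoadjAlg V G)).1) x := by
    have h1 := mdifferentiableAt_mul hE.mdifferentiableAt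
      (mdifferentiableAt_const (c := (expNeg ((φ x).D : CoadjAlg V G)).1))
    simpa only [inv_mul_cancel_right] using h1
  have hEl : rightLog 𝓘(ℝ, V) (fun y => (expNeg ((φ y).D : CoadjAlg V G)).1) x = -dMu φ x :=
    rightLog_eq_of_hasMFDerivAt hE
  -- on the constraint surface the total holonomy is `v_∞ e^{-μ} v_∞⁻¹`
  have hK : (fun y => ((φ y).invK D₀).1) =ᶠ[𝓝 x] fun y =>
      (φ y).gInf.1 * (expNeg ((φ y).D : CoadjAlg V G)).1 * ((φ y).gInf.1)⁻¹ := by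
    filter_upwards [hU.mem_nhds hx] with y hy
    exact congrArg Prod.fst (hC y hy)
  have hK0 : ((φ x).invK D₀).1 = (φ x).gInf.1 * (expNeg ((φ x).D : CoadjAlg V G)).1
      * ((φ x).gInf.1)⁻¹ := hK.self_of_nhds
  have hKl : rightLog 𝓘(ℝ, V) (fun y => ((φ y).invK D₀).1) x e
      = rightLog 𝓘(ℝ, V) (fun y => (φ y).gInf.1) x e - Ad V (φ x).gInf.1 (dMu φ x e)
        - Ad V ((φ x).invK D₀).1 (rightLog 𝓘(ℝ, V) (fun y => (φ y).gInf.1) x e) := by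
    rw [rightLog_congr hK, rightLog_mul (mdifferentiableAt_mul hv hEd) (mdifferentiableAt_inv hv),
      rightLog_mul hv hEd, rightLog_inv hv, hEl, hK0]
    simp only [add_apply, neg_apply, ContinuousLinearMap.comp_apply, Ad_mul_apply, map_neg]
    abel
  have hΘ := Theta_conj (h := h) (v := fun i y => ((φ y).gM i).1)
    (c := fun i => (expNeg (D₀ i)).1) (M := fun i y => (φ y).M D₀ i)
    (A := fun i y => (φ y).A i) (B := fun i y => (φ y).B i) (x := x)
    (fun i y => rfl) hh hgM hA hB e
  rw [potential_apply, potential_apply]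
  simp only [ExtPhase.gauge_M, ExtPhase.gauge_invK]
  have hv' : rightLog 𝓘(ℝ, V) (fun y => ((φ y).gauge (h y)).gInf.1) x e
      = Ad V (h x).1 (adInvLog (fun y => (h y).1) x e
        + rightLog 𝓘(ℝ, V) (fun y => (φ y).gInf.1) x e) := rightLog_mul_left_eq hh hv e
  have hj : ((φ x).gauge (h x)).gInf.j (dMu φ x e)
      = (h x).j (Ad V (φ x).gInf.1 (dMu φ x e)) + (φ x).gInf.j (dMu φ x e) := j_mul_apply _ _ _
  have hw : wForm (fun y => (φ y).gauge (h y)) x e = wForm φ x e := rfl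
  have hmu : dMu (fun y => (φ y).gauge (h y)) x e = dMu φ x e := rfl
  have hs : (((φ x).gauge (h x)).D : CoadjAlg V G).2 = ((φ x).D : CoadjAlg V G).2 := rfl
  have hT : Theta (fun i y => (((φ y).gauge (h y)).gM i).1)
      (fun i y => h y * (φ y).M D₀ i * (h y)⁻¹) (fun i y => ((φ y).gauge (h y)).A i)
      (fun i y => ((φ y).gauge (h y)).B i) x e = _ := hΘ
  rw [hT, hv', hw, hmu, hs, hj, j_conj_apply]
  have hK' : ∀ y, totalHol (fun i => (φ y).M D₀ i) (fun i => (φ y).A i) (fun i => (φ y).B i)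
      = (φ y).invK D₀ := fun _ => rfl
  simp only [hK', twistedLog, sub_apply, ContinuousLinearMap.comp_apply, hKl, map_add, map_sub]
  ring

end Potential

/-! ### Families that do not depend on an additional parameter -/

section Projection

set_option linter.unusedSectionVars false

variable {E : Type*} [NormedAddCommGroup E] [NormedSpace ℝ E]

/-- The chain rule for the projection `ℝ × E → E`. No differentiability of `f` is needed, since
`f` can be recovered from `f ∘ Prod.snd` by restriction to a slice. -/
theorem mfderiv_comp_snd {F : Type*} [NormedAddCommGroup F] [NormedSpace ℝ F]
    {M : Type*} [TopologicalSpace M] (J : ModelWithCorners ℝ F M)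
    {K : Type*} [TopologicalSpace K] [ChartedSpace M K] (f : E → K) (p : ℝ × E) :
    (mfderiv 𝓘(ℝ, ℝ × E) J (fun q : ℝ × E => f q.2) p : ℝ × E →L[ℝ] F)
      = (mfderiv 𝓘(ℝ, E) J f p.2 : E →L[ℝ] F).comp (ContinuousLinearMap.snd ℝ ℝ E) := by
  by_cases h : MDifferentiableAt 𝓘(ℝ, E) J f p.2
  · have h1 : HasMFDerivAt 𝓘(ℝ, ℝ × E) 𝓘(ℝ, E) (Prod.snd : ℝ × E → E) p
        (ContinuousLinearMap.snd ℝ ℝ E) := hasFDerivAt_snd.hasMFDerivAt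
    exact (HasMFDerivAt.comp p h.hasMFDerivAt h1).mfderiv
  · have h2 : ¬ MDifferentiableAt 𝓘(ℝ, ℝ × E) J (fun q : ℝ × E => f q.2) p := by
      intro h3
      have h4 : MDifferentiableAt 𝓘(ℝ, E) 𝓘(ℝ, ℝ × E) (fun y : E => (p.1, y)) p.2 :=
        (hasFDerivAt_prodMk_right p.1 p.2).differentiableAt.mdifferentiableAt
      exact h (MDifferentiableAt.comp (g := fun q : ℝ × E => f q.2) (f := fun y : E => (p.1, y))
        p.2 h3 h4)
    rw [mfderiv_zero_of_not_mdifferentiableAt h, mfderiv_zero_of_not_mdifferentiableAt h2]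
    rfl

variable {V : Type*} [NormedAddCommGroup V] [NormedSpace ℝ V] [FiniteDimensional ℝ V]
  {G : Type*} [TopologicalSpace G] [ChartedSpace V G] [Group G] [LieGroup 𝓘(ℝ, V) ∞ G]
  {n g : ℕ} {c : LieSubalgebra ℝ (CoadjAlg V G)} (D₀ : Fin n → CoadjAlg V G)

theorem potential_comp_snd (φ : E → ExtPhase n g c) (p : ℝ × E) :
    potential D₀ (fun q : ℝ × E => φ q.2) p
      = (potential D₀ φ p.2).comp (ContinuousLinearMap.snd ℝ ℝ E) := by
  have hr : ∀ (f : E → G) (a : ℝ × E), rightLog 𝓘(ℝ, V) (fun q : ℝ × E => f q.2) p a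
      = rightLog 𝓘(ℝ, V) f p.2 a.2 := fun f a =>
    DFunLike.congr_fun (mfderiv_comp_snd 𝓘(ℝ, V) (fun y => f y * (f p.2)⁻¹) p) a
  have hw : wForm (fun q : ℝ × E => φ q.2) p
      = (wForm φ p.2).comp (ContinuousLinearMap.snd ℝ ℝ E) := by
    refine ContinuousLinearMap.ext fun a => ?_
    exact congrArg (CoadjAlg.pairing ((φ p.2).D : CoadjAlg V G)) (DFunLike.congr_fun
      (mfderiv_comp_snd (CoadjGroup.model V) (fun y => ((φ p.2).w)⁻¹ * (φ y).w) p) a)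
  have hmu : dMu (fun q : ℝ × E => φ q.2) p
      = (dMu φ p.2).comp (ContinuousLinearMap.snd ℝ ℝ E) := by
    have := mfderiv_comp_snd 𝓘(ℝ, V) (fun y => ((φ y).D : CoadjAlg V G).1) p
    simp only [mfderiv_eq_fderiv] at this
    exact this
  have hΘ : Theta (fun i (q : ℝ × E) => ((φ q.2).gM i).1) (fun i q => (φ q.2).M D₀ i)
      (fun i q => (φ q.2).A i) (fun i q => (φ q.2).B i) p
      = (Theta (fun i y => ((φ y).gM i).1) (fun i y => (φ y).M D₀ i) (fun i y => (φ y).A i)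
          (fun i y => (φ y).B i) p.2).comp (ContinuousLinearMap.snd ℝ ℝ E) := by
    refine ContinuousLinearMap.ext fun a => ?_
    simp only [Theta, add_apply, sum_apply,
      ContinuousLinearMap.comp_apply, sub_apply, ContinuousLinearMap.coe_snd', ← hr]
  refine ContinuousLinearMap.ext fun a => ?_
  rw [ContinuousLinearMap.comp_apply, potential_apply, potential_apply, hw, hmu, hΘ,
    hr (fun y => (φ y).gInf.1)]
  rfl

theorem IsSmoothFamily.comp_snd {U : Set E} {φ : E → ExtPhase n g c} (hφ : IsSmoothFamily U φ) :
    IsSmoothFamily (Set.univ ×ˢ U : Set (ℝ × E)) (fun q => φ q.2) where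
  gM i := (hφ.gM i).comp contDiff_snd.contMDiff.contMDiffOn (fun _ hq => hq.2)
  A i := (hφ.A i).comp contDiff_snd.contMDiff.contMDiffOn (fun _ hq => hq.2)
  B i := (hφ.B i).comp contDiff_snd.contMDiff.contMDiffOn (fun _ hq => hq.2)
  gInf := hφ.gInf.comp contDiff_snd.contMDiff.contMDiffOn (fun _ hq => hq.2)
  w := hφ.w.comp contDiff_snd.contMDiff.contMDiffOn (fun _ hq => hq.2)
  D := hφ.D.comp contDiff_snd.contDiffOn (fun _ hq => hq.2)

end Projection

/-! ### The two-form on the constraint surface -/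

section TwoForm

set_option linter.unusedSectionVars false

variable {V : Type*} [NormedAddCommGroup V] [NormedSpace ℝ V] [FiniteDimensional ℝ V]
  {G : Type*} [TopologicalSpace G] [T2Space G] [ChartedSpace V G] [Group G]
  [LieGroup 𝓘(ℝ, V) ∞ G]
  {E : Type*} [NormedAddCommGroup E] [NormedSpace ℝ E]
  {n g : ℕ} {c : LieSubalgebra ℝ (CoadjAlg V G)} [IsLieAbelian c] (D₀ : Fin n → CoadjAlg V G)
  (k : ℝ) {U : Set E} {φ : E → ExtPhase n g c}

theorem Omega_gauge (hU : IsOpen U) (hφ : IsSmoothFamily U φ)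
    (hC : ∀ x ∈ U, φ x ∈ ExtPhase.constraintSurface D₀) {h : E → CoadjGroup V G}
    (hh : ContMDiffOn 𝓘(ℝ, E) (CoadjGroup.model V) ∞ h U) {x : E} (hx : x ∈ U) :
    Omega D₀ k (fun y => (φ y).gauge (h y)) x = Omega D₀ k φ x := by
  have h1 : potential D₀ (fun y => (φ y).gauge (h y)) =ᶠ[𝓝 x] potential D₀ φ := by
    filter_upwards [hU.mem_nhds hx] with y hy
    exact potential_gauge D₀ hU hφ hC hy (mdifferentiableAt_fst_of_contMDiffOn hh hU hy)
  rw [Omega, Omega, extD_congr h1]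

/-- By gauge invariance of the potential, applied to the family `(t, x) ↦ γ(t)·φ(x)` on `ℝ × E`, the
form is the pull-back of a form on `E`. -/
theorem Omega_gauge_curve_apply (hU : IsOpen U) (hφ : IsSmoothFamily U φ)
    (hC : ∀ x ∈ U, φ x ∈ ExtPhase.constraintSurface D₀) {γ : ℝ → CoadjGroup V G}
    (hγ : ContMDiff 𝓘(ℝ, ℝ) (CoadjGroup.model V) ∞ γ) {p : ℝ × E} (hp : p.2 ∈ U) (a : ℝ × E) :
    Omega D₀ k (fun q : ℝ × E => (φ q.2).gauge (γ q.1)) p ![(1, 0), a] = 0 := by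
  have hγ' : ContMDiff 𝓘(ℝ, ℝ × E) (CoadjGroup.model V) ∞ (fun q : ℝ × E => γ q.1) :=
    hγ.comp contDiff_fst.contMDiff
  have h1 : ∀ b : ℝ × E, Omega D₀ k (fun q : ℝ × E => φ q.2) p ![(1, 0), b] = 0 := by
    intro b
    have h2 : potential D₀ (fun q : ℝ × E => φ q.2)
        = fun q => (potential D₀ φ q.2).comp (ContinuousLinearMap.snd ℝ ℝ E) :=
      funext (potential_comp_snd D₀ φ)
    rw [Omega, h2]
    change (k / (2 * Real.pi)) • extD _ p ![(1, 0), b] = 0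
    rw [extD_comp_snd_apply, smul_zero]
  rw [Omega_gauge D₀ k (isOpen_univ.prod hU) hφ.comp_snd (fun q hq => hC q.2 hq.2)
    hγ'.contMDiffOn (Set.mk_mem_prod (Set.mem_univ _) hp)]
  exact h1 a

/-- After the gauge transformation by `g_∞⁻¹` the group element `g_∞` becomes trivial, and only the
term `⟨s, δμ⟩ / 2` remains of the last two terms of the symplectic potential. -/
theorem potential_eq_fixedPotential_add (hU : IsOpen U) (hφ : IsSmoothFamily U φ)
    (hC : ∀ x ∈ U, φ x ∈ ExtPhase.constraintSurface D₀) {x : E} (hx : x ∈ U) :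
    potential D₀ φ x = fixedPotential D₀ φ x + fderiv ℝ (fun y =>
      (1 / 2 : ℝ) * ((φ y).D : CoadjAlg V G).2 ((φ y).D : CoadjAlg V G).1) x := by
  have hD := (hφ.D.contDiffAt (hU.mem_nhds hx)).differentiableAt (by simp)
  have hmu : DifferentiableAt ℝ (fun y => ((φ y).D : CoadjAlg V G).1) x :=
    (coadjAlgFst (V := V) (G := G)).differentiableAt.comp x hD
  have hs : DifferentiableAt ℝ (fun y => ((φ y).D : CoadjAlg V G).2) x :=
    (coadjAlgSnd (V := V) (G := G)).differentiableAt.comp x hD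
  have hv := mdifferentiableAt_fst_of_contMDiffOn hφ.gInf hU hx
  have hd : HasFDerivAt (fun y =>
      (1 / 2 : ℝ) * ((φ y).D : CoadjAlg V G).2 ((φ y).D : CoadjAlg V G).1) _ x :=
    (hs.hasFDerivAt.clm_apply hmu.hasFDerivAt).const_mul (1 / 2 : ℝ)
  have hg := potential_gauge D₀ hU hφ hC (h := fun y => ((φ y).gInf)⁻¹) hx
    (mdifferentiableAt_inv hv)
  ext e
  rw [← hg, potential_apply, hd.fderiv]
  simp only [ExtPhase.gauge_M]
  have h1 : (fun y => ((φ y).gauge ((φ y).gInf)⁻¹).gInf) = fun _ => 1 :=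
    funext fun y => inv_mul_cancel _
  have h2 : rightLog 𝓘(ℝ, V) (fun y => ((φ y).gauge ((φ y).gInf)⁻¹).gInf.1) x = 0 := by
    have h3 : (fun y => ((φ y).gauge ((φ y).gInf)⁻¹).gInf.1) = fun _ => 1 :=
      funext fun y => inv_mul_cancel (φ y).gInf.1
    rw [h3, rightLog_const]
  rw [h2, congrFun h1 x, CoadjGroup.j_one]
  simp only [ExtPhase.gauge, inv_inv, fixedPotential, add_apply, sub_apply, smul_apply,
    ContinuousLinearMap.comp_apply, smul_eq_mul, ContinuousLinearMap.flip_apply]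
  change wForm φ x e + Theta _ _ _ _ x e + _ + (0 : ℝ)
        + (1 / 2 : ℝ) * ((φ x).D : CoadjAlg V G).2 (dMu φ x e)
    = wForm φ x e - (1 / 2 : ℝ) * (dS φ x e) _ + Theta _ _ _ _ x e
      + (1 / 2 : ℝ) * (((φ x).D : CoadjAlg V G).2 (dMu φ x e) + (dS φ x e) _)
  have h4 : ∀ i y, ((φ y).gInf⁻¹ * (φ y).gM i).1 = (φ y).gInf.1⁻¹ * ((φ y).gM i).1 :=
    fun _ _ => rfl
  simp only [h4, zero_apply, map_zero]
  ring

theorem Omega_eq_extD_fixedPotential (hU : IsOpen U) (hφ : IsSmoothFamily U φ)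
    (hC : ∀ x ∈ U, φ x ∈ ExtPhase.constraintSurface D₀) {x : E} (hx : x ∈ U) :
    Omega D₀ k φ x = (k / (2 * Real.pi)) • extD (fixedPotential D₀ φ) x := by
  have hD := hφ.D.contDiffAt (hU.mem_nhds hx)
  have hmu : ContDiffAt ℝ ∞ (fun y => ((φ y).D : CoadjAlg V G).1) x :=
    (coadjAlgFst (V := V) (G := G)).contDiff.contDiffAt.comp x hD
  have hs : ContDiffAt ℝ ∞ (fun y => ((φ y).D : CoadjAlg V G).2) x :=
    (coadjAlgSnd (V := V) (G := G)).contDiff.contDiffAt.comp x hD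
  have hf : ContDiffAt ℝ ∞ (fun y =>
      (1 / 2 : ℝ) * ((φ y).D : CoadjAlg V G).2 ((φ y).D : CoadjAlg V G).1) x :=
    contDiffAt_const.mul (hs.clm_apply hmu)
  have h1 : potential D₀ φ =ᶠ[𝓝 x] fun y => fixedPotential D₀ φ y + fderiv ℝ (fun y =>
      (1 / 2 : ℝ) * ((φ y).D : CoadjAlg V G).2 ((φ y).D : CoadjAlg V G).1) y := by
    filter_upwards [hU.mem_nhds hx] with y hy
    exact potential_eq_fixedPotential_add D₀ hU hφ hC hy
  rw [Omega, extD_congr h1, extD_add_fderiv _ hf]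

end TwoForm

/-! ### The holonomy around the distinguished puncture -/

section Holonomy

set_option linter.unusedSectionVars false

variable {V : Type*} [NormedAddCommGroup V] [NormedSpace ℝ V] [FiniteDimensional ℝ V]
  {G : Type*} [TopologicalSpace G] [ChartedSpace V G] [Group G] [LieGroup 𝓘(ℝ, V) ∞ G]
  {n g : ℕ} {c : LieSubalgebra ℝ (CoadjAlg V G)} (D₀ : Fin n → CoadjAlg V G)

theorem totalHol_conj_gInf_inv {p : ExtPhase n g c} (hp : p ∈ ExtPhase.constraintSurface D₀) :
    totalHol (fun i => p.gInf⁻¹ * p.M D₀ i * p.gInf) (fun i => p.gInf⁻¹ * p.A i * p.gInf)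
      (fun i => p.gInf⁻¹ * p.B i * p.gInf) = expNeg (p.D : CoadjAlg V G) := by
  have h := totalHol_conj p.gInf⁻¹ (p.M D₀) p.A p.B
  have hp' : totalHol (p.M D₀) p.A p.B = p.gInf * expNeg (p.D : CoadjAlg V G) * p.gInf⁻¹ := hp
  rw [hp'] at h
  simp only [inv_inv] at h
  rw [h]
  group

/-- The one-parameter subgroup `t ↦ (e^{tξ}, 0)` of `G ⋉ 𝔤*`. -/
theorem isOneParamSubgroup_mk_zero [T2Space G] (ξ : V) :
    IsOneParamSubgroup (CoadjGroup.model V)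
      (fun t : ℝ => CoadjGroup.mk V (lieExp 𝓘(ℝ, V) (t • ξ) : G) 0)
      ((ξ, 0) : V × StrongDual ℝ V) := by
  have h : IsOneParamSubgroup 𝓘(ℝ, V) (fun t : ℝ => (lieExp 𝓘(ℝ, V) (t • ξ) : G)) ξ :=
    isOneParamSubgroup_lieExp ξ
  refine ⟨fun s t => ?_, ?_, ?_⟩
  · refine Prod.ext (h.map_add s t) ?_
    change (0 : StrongDual ℝ V) = 0 + (0 : StrongDual ℝ V).comp _
    simp
  · exact h.smooth.prodMk (contMDiff_const (c := (0 : StrongDual ℝ V)))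
  · have h1 := h.hasMFDerivAt_zero.prodMk
      (hasMFDerivAt_const (I := 𝓘(ℝ, ℝ)) (I' := 𝓘(ℝ, StrongDual ℝ V)) (0 : StrongDual ℝ V) (0 : ℝ))
    have h2 := DFunLike.congr_fun h1.mfderiv (1 : ℝ)
    refine h2.trans ?_
    refine Prod.ext ?_ rfl
    exact one_smul ℝ ξ

/-- The one-parameter subgroup `t ↦ (1, t s)` of `G ⋉ 𝔤*`. -/
theorem isOneParamSubgroup_mk_one (s : StrongDual ℝ V) :
    IsOneParamSubgroup (CoadjGroup.model V) (fun t : ℝ => CoadjGroup.mk V (1 : G) (t • s))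
      ((0, s) : V × StrongDual ℝ V) := by
  refine ⟨fun a b => ?_, ?_, ?_⟩
  · refine Prod.ext (mul_one (1 : G)).symm ?_
    change (a + b) • s = a • s + coAd V (1 : G)⁻¹ (b • s)
    simp [coAd, Ad_one, add_smul]
  · exact (contMDiff_const (c := (1 : G))).prodMk
      (contDiff_id.smul contDiff_const : ContDiff ℝ ∞ (fun t : ℝ => t • s)).contMDiff
  · have h0 : HasMFDerivAt 𝓘(ℝ, ℝ) 𝓘(ℝ, StrongDual ℝ V) (fun t : ℝ => t • s) 0
        ((ContinuousLinearMap.id ℝ ℝ).smulRight s) :=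
      ((hasFDerivAt_id (0 : ℝ)).smul_const s).hasMFDerivAt
    have h1 := (hasMFDerivAt_const (I := 𝓘(ℝ, ℝ)) (I' := 𝓘(ℝ, V)) (1 : G) (0 : ℝ)).prodMk h0
    have h2 := DFunLike.congr_fun h1.mfderiv (1 : ℝ)
    refine h2.trans ?_
    refine Prod.ext rfl ?_
    exact one_smul ℝ s

/-- If `𝔠` is compatible with the decomposition `𝔤 ⊕ 𝔤*`, both factors of
`(e^{-μ}, -s) = (1, -s) (e^{-μ}, 0)` lie in one-parameter subgroups generated by elements
of `𝔠`. -/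
theorem expNeg_mem_cartanSubgroup [T2Space G]
    (hc : ∀ ξ ∈ c, ((ξ.1, 0) : V × StrongDual ℝ V) ∈ c) {D : CoadjAlg V G} (hD : D ∈ c) :
    expNeg D ∈ cartanSubgroup c := by
  have h1 : ((-D.1, 0) : V × StrongDual ℝ V) ∈ c := hc (-D) (c.neg_mem hD)
  have h2 : ((0, -D.2) : V × StrongDual ℝ V) ∈ c := by
    have h3 := c.sub_mem (c.neg_mem hD) h1
    have h4 : -D - (show CoadjAlg V G from (-D.1, 0))
        = ((0, -D.2) : V × StrongDual ℝ V) :=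
      Prod.ext (sub_self (-D.1)) (sub_zero (-D.2))
    rwa [← h4]
  have e : expNeg D = CoadjGroup.mk V (1 : G) (-D.2)
      * CoadjGroup.mk V (lieExp 𝓘(ℝ, V) (-D.1)) 0 := by
    refine Prod.ext (one_mul _).symm ?_
    change -D.2 = -D.2 + (0 : StrongDual ℝ V).comp _
    simp
  rw [e]
  refine Subgroup.mul_mem _ (Subgroup.subset_closure ⟨_, h2, _, isOneParamSubgroup_mk_one _, ?_⟩)
    (Subgroup.subset_closure ⟨_, h1, _, isOneParamSubgroup_mk_zero _, ?_⟩)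
  · simp only [one_smul]
  · simp only [one_smul]

end Holonomy

theorem theorem2
    {V : Type*} [NormedAddCommGroup V] [NormedSpace ℝ V] [FiniteDimensional ℝ V]
    {G : Type*} [TopologicalSpace G] [T2Space G] [ConnectedSpace G] [ChartedSpace V G] [Group G]
    [LieGroup 𝓘(ℝ, V) ∞ G]
    (c : LieSubalgebra ℝ (CoadjAlg V G)) [c.IsCartanSubalgebra] [IsLieAbelian c]
    (k : ℝ) (n g : ℕ) (D₀ : Fin n → CoadjAlg V G) :
    -- the action preserves the constraint surface and conjugates all holonomies
    (∀ (h : CoadjGroup V G) (p : ExtPhase n g c),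
      (∀ i, (p.gauge h).M D₀ i = h * p.M D₀ i * h⁻¹) ∧
      (p.gauge h).invK D₀ = h * p.invK D₀ * h⁻¹ ∧
      (p ∈ ExtPhase.constraintSurface D₀ → p.gauge h ∈ ExtPhase.constraintSurface D₀)) ∧
    -- for every smooth family of points of the constraint surface:
    (∀ {E : Type*} [NormedAddCommGroup E] [NormedSpace ℝ E] [FiniteDimensional ℝ E]
      (U : Set E) (φ : E → ExtPhase n g c), IsOpen U → IsSmoothFamily U φ →
      (∀ x ∈ U, φ x ∈ ExtPhase.constraintSurface D₀) →
      -- invariance of the two-form under field-dependent transformations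
      (∀ h : E → CoadjGroup V G, ContMDiffOn 𝓘(ℝ, E) (CoadjGroup.model V) ∞ h U →
        ∀ x ∈ U, Omega D₀ k (fun y => (φ y).gauge (h y)) x = Omega D₀ k φ x) ∧
      -- the two-form is degenerate in the directions of the infinitesimal transformations
      (∀ γ : ℝ → CoadjGroup V G, ContMDiff 𝓘(ℝ, ℝ) (CoadjGroup.model V) ∞ γ → γ 0 = 1 →
        ∀ x ∈ U, ∀ a : ℝ × E,
          Omega D₀ k (fun q : ℝ × E => (φ q.2).gauge (γ q.1)) (0, x) ![(1, 0), a] = 0) ∧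
      -- the two-form in the conjugated variables
      (∀ x ∈ U, Omega D₀ k φ x = (k / (2 * Real.pi)) • extD (fixedPotential D₀ φ) x)) ∧
    -- the conjugated holonomy around the distinguished puncture
    (∀ p ∈ ExtPhase.constraintSurface (c := c) (g := g) D₀,
      totalHol (fun i => p.gInf⁻¹ * p.M D₀ i * p.gInf) (fun i => p.gInf⁻¹ * p.A i * p.gInf)
        (fun i => p.gInf⁻¹ * p.B i * p.gInf) = expNeg (p.D : CoadjAlg V G) ∧
      ((∀ ξ ∈ c, ((ξ.1, 0) : V × StrongDual ℝ V) ∈ c) →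
        expNeg (p.D : CoadjAlg V G) ∈ cartanSubgroup c)) := by
  refine ⟨fun h p => ⟨p.gauge_M D₀ h, p.gauge_invK D₀ h,
    fun hp => ExtPhase.gauge_mem_constraintSurface D₀ h hp⟩, ?_, fun p hp =>
    ⟨totalHol_conj_gInf_inv D₀ hp, fun hc => expNeg_mem_cartanSubgroup hc p.D.2⟩⟩
  intro E _ _ _ U φ hU hφ hC
  exact ⟨fun h hh x hx => Omega_gauge D₀ k hU hφ hC hh hx,
    fun γ hγ _ x hx a => Omega_gauge_curve_apply D₀ k hU hφ hC hγ (p := (0, x)) hx a,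
    fun x hx => Omega_eq_extD_fixedPotential D₀ k hU hφ hC hx⟩

end
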